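/- Let $k$ be an algebraically closed field and let $N\ge 1$ and $1\le d_1<d_2$ be integers. Let $\bar H_{d_1}=\mathbb P(H^0(\mathbb P^N,\mathcal O(d_1)))$, and let $\bar H_{d_1,d_2}\to\bar H_{d_1}$ be the projective bundle whose fibre over $\langle F\rangle$ is $\mathbb P(H^0(\mathbb P^N,\mathcal O(d_2))/\langle F\rangle)$ (projective spaces of lines). Its points are written $[F,G]$, with $F\ne 0$ and $F\nmid G$. Let $\mathcal O(1,0)$ be the pull-back of $\mathcal O(1)$ from $\bar H_{d_1}$, let $\mathcal O(0,1)$ be the relative $\mathcal O(1)$, and $\mathcal O(l_1,l_2)=\mathcal O(1,0)^{\otimes l_1}\otimes\mathcal O(0,1)^{\otimes l_2}$; its sections are the regular functions $s(F,G)$ with $s(aF,bG+KF)=a^{l_1}b^{l_2}s(F,G)$ for $a,b\in k^*$ and forms $K$ of degree $d_2-d_1$. Then: 1. The line bundle $\mathcal O(d_2-d_1+1,1)$ on $\bar H_{d_1,d_2}$ is base-point free. 2. The line bundle $\mathcal O(d_2-d_1+1,1)$ is not ample. 3. If $(N,d_1)\neq(1,1)$, the line bundle $\mathcal O(l_1,l_2)$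 (with $l_1,l_2\in\mathbb Z$) is nef if and only if $(l_1,l_2)=a(1,0)+b(d_2-d_1+1,1)$ for some integers $a,b\ge 0$. Thus $\mathcal O(d_2-d_1+1,1)$ generates the boundary ray of the nef cone other than the one generated by $\mathcal O(1,0)$. 4. Let $f=\sum_M f^{(M)}M$ and $g=\sum_M g^{(M)}M$ be the generic forms of degrees $d_1$ and $d_2$ in $X_0,\dots,X_N$, with indeterminate coefficients. In the polynomial ring $A=k[X_s,f^{(M)},g^{(M)}]$, trigraded by the degrees in the $X_s$, the $f^{(M)}$ and the $g^{(M)}$, there are $q,r$ homogeneous of degrees $(d_2-d_1,d_2-d_1,1)$ and $(d_2,d_2-d_1+1,1)$ such that no monomial of $r$ is divisible by $X_0^{d_1}$ and $$\bigl(f^{(X_0^{d_1})}\bigr)^{d_2-d_1+1}g=qf+r,$$ and which have the following property. For every monomial $M$ of degree $d_2$ and every linear coordinate system on $\mathbb P^N$, evaluating the coefficient of $M$ in $r$ at the coefficients of $F$ and $G$ in that coordinate system defines a global section of $\mathcal O(d_2-d_1+1,1)$, and these sections (for all $M$ and all coordinate systems) have no common zero on $\bar H_{d_1,d_2}$. 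-/

import Mathlib

noncomputable section

open scoped Topology

namespace CompleteIntersection

/-! ### Regular functions and the Zariski topology on spaces presented by affine coordinates -/

section Zariski

variable {k : Type*} [Field k] {ι T X : Type*}

/-- Let `T` be a set of points with affine coordinates `coords : T → k^ι`. A function `s : T → k`
is regular at `t` if near `t` (for the Zariski topology) it is a quotient of two polynomials in
the coordinates. -/
def RegularAt (coords : T → ι → k) (s : T → k) (t : T) : Prop :=
  ∃ p q : MvPolynomial ι k, MvPolynomial.eval (coords t) q ≠ 0 ∧
    ∀ t' : T, MvPolynomial.eval (coords t') q ≠ 0 →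
      s t' = MvPolynomial.eval (coords t') p / MvPolynomial.eval (coords t') q

/-- The Zariski topology on `T`: the basic open sets are the non-vanishing loci of polynomials
in the coordinates. -/
@[reducible] def zariski (coords : T → ι → k) : TopologicalSpace T :=
  TopologicalSpace.generateFrom
    {D | ∃ p : MvPolynomial ι k, D = {t | MvPolynomial.eval (coords t) p ≠ 0}}

/-- A function on a quotient `π : T → X` is regular at `x` if its pull-back to `T` is regular at
every point over `x`. -/
def QuotientRegularAt (coords : T → ι → k) (π : T → X) (h : X → k) (x : X) : Prop :=
  ∀ t : T, π t = x → RegularAt coords (fun t' => h (π t')) t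

theorem RegularAt.const (coords : T → ι → k) (a : k) (t : T) :
    RegularAt coords (fun _ => a) t :=
  ⟨MvPolynomial.C a, 1, by simp, fun t' _ => by simp⟩

theorem RegularAt.add {coords : T → ι → k} {s s' : T → k} {t : T}
    (h : RegularAt coords s t) (h' : RegularAt coords s' t) :
    RegularAt coords (fun x => s x + s' x) t := by
  obtain ⟨p, q, hq, H⟩ := h
  obtain ⟨p', q', hq', H'⟩ := h'
  refine ⟨p * q' + q * p', q * q', by simp [hq, hq'], fun t' ht' => ?_⟩
  rw [map_mul] at ht'
  have h1 := left_ne_zero_of_mul ht'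
  have h2 := right_ne_zero_of_mul ht'
  simp only [H t' h1, H' t' h2, map_add, map_mul, div_add_div _ _ h1 h2]

theorem RegularAt.mul {coords : T → ι → k} {s s' : T → k} {t : T}
    (h : RegularAt coords s t) (h' : RegularAt coords s' t) :
    RegularAt coords (fun x => s x * s' x) t := by
  obtain ⟨p, q, hq, H⟩ := h
  obtain ⟨p', q', hq', H'⟩ := h'
  refine ⟨p * p', q * q', by simp [hq, hq'], fun t' ht' => ?_⟩
  rw [map_mul] at ht'
  have h1 := left_ne_zero_of_mul ht'
  have h2 := right_ne_zero_of_mul ht'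
  simp only [H t' h1, H' t' h2, map_mul, div_mul_div_comm]

end Zariski

/-! ### Projective space -/

/-- The projective space of dimension `n` over `k`, as a classical variety. -/
def ProjSpace (k : Type*) [Field k] (n : ℕ) : Type _ := Projectivization k (Fin (n + 1) → k)

namespace ProjSpace

variable {k : Type*} [Field k] {n : ℕ}

/-- Affine coordinates on the cone of nonzero vectors. -/
def coords (v : {v : Fin (n + 1) → k // v ≠ 0}) : Fin (n + 1) → k := v.1

/-- The projection from the cone of nonzero vectors to projective space. -/
def proj (v : {v : Fin (n + 1) → k // v ≠ 0}) : ProjSpace k n := Projectivization.mk k v.1 v.2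

instance : TopologicalSpace (ProjSpace k n) := (zariski coords).coinduced proj

/-- Regular functions on projective space. -/
def IsRegularAt (h : ProjSpace k n → k) (x : ProjSpace k n) : Prop :=
  QuotientRegularAt coords proj h x

end ProjSpace

/-! ### The variety of pairs `[F, G]` -/

/-- The space of forms of degree `d` in `X₀, …, X_N`, i.e. the global sections of `𝒪(d)` on
projective `N`-space. -/
abbrev Forms (k : Type*) [Field k] (N d : ℕ) : Submodule k (MvPolynomial (Fin (N + 1)) k) :=
  MvPolynomial.homogeneousSubmodule (Fin (N + 1)) k d

/-- The monomials of degree `d` in `X₀, …, X_N`, given by their exponents. -/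
abbrev Mon (N d : ℕ) : Type :=
  {m : Fin (N + 1) →₀ ℕ // m ∈ Finset.finsuppAntidiag (Finset.univ : Finset (Fin (N + 1))) d}

section Hbar

variable {k : Type*} [Field k] {N d₁ d₂ : ℕ}

/-- The ideal generated by the line `⟨F⟩`. -/
def lineIdeal (x : Projectivization k (Forms k N d₁)) : Ideal (MvPolynomial (Fin (N + 1)) k) :=
  Ideal.span ((fun F : Forms k N d₁ => (F : MvPolynomial (Fin (N + 1)) k)) ''
    (x.submodule : Set (Forms k N d₁)))

/-- The space of forms of degree `d₂` lying in the ideal `⟨F⟩`. -/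
def multiples (x : Projectivization k (Forms k N d₁)) (d₂ : ℕ) : Submodule k (Forms k N d₂) :=
  ((lineIdeal x).restrictScalars k).comap (Forms k N d₂).subtype

variable (k N d₁ d₂) in
/-- The projective bundle over `ℙ(H⁰(ℙ^N, 𝒪(d₁)))` whose fibre over `⟨F⟩` is
`ℙ(H⁰(ℙ^N, 𝒪(d₂)) / ⟨F⟩)` (projective spaces of lines). -/
def Hbar : Type _ :=
  Σ x : Projectivization k (Forms k N d₁), Projectivization k (Forms k N d₂ ⧸ multiples x d₂)

variable (k N d₁ d₂) in
/-- The pairs `(F, G)` of forms of degrees `d₁`, `d₂` that define a point `[F, G]`: `F ≠ 0` and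
`F` does not divide `G`. -/
structure Cone where
  F : Forms k N d₁
  G : Forms k N d₂
  F_ne : F ≠ 0
  not_dvd : ¬ (F : MvPolynomial (Fin (N + 1)) k) ∣ (G : MvPolynomial (Fin (N + 1)) k)

theorem mem_multiples_mk (F : Forms k N d₁) (hF : F ≠ 0) (G : Forms k N d₂) :
    G ∈ multiples (Projectivization.mk k F hF) d₂ ↔
      (F : MvPolynomial (Fin (N + 1)) k) ∣ (G : MvPolynomial (Fin (N + 1)) k) := by
  have key : lineIdeal (Projectivization.mk k F hF) =
      Ideal.span {(F : MvPolynomial (Fin (N + 1)) k)} := by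
    apply le_antisymm
    · rw [lineIdeal, Ideal.span_le]
      rintro _ ⟨F', hF', rfl⟩
      rw [Projectivization.submodule_mk, SetLike.mem_coe, Submodule.mem_span_singleton] at hF'
      obtain ⟨a, rfl⟩ := hF'
      rw [SetLike.mem_coe, Ideal.mem_span_singleton]
      exact ⟨MvPolynomial.C a, by
        rw [mul_comm, ← MvPolynomial.smul_eq_C_mul]; rfl⟩
    · rw [Ideal.span_singleton_le_iff_mem]
      refine Ideal.subset_span ⟨F, ?_, rfl⟩
      rw [Projectivization.submodule_mk]
      exact Submodule.mem_span_singleton_self F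
  change (G : MvPolynomial (Fin (N + 1)) k) ∈ lineIdeal (Projectivization.mk k F hF) ↔ _
  rw [key, Ideal.mem_span_singleton]

/-- The point `[F, G]`. -/
def Cone.mk' (c : Cone k N d₁ d₂) : Hbar k N d₁ d₂ :=
  ⟨Projectivization.mk k c.F c.F_ne,
    Projectivization.mk k (Submodule.Quotient.mk c.G) (by
      rw [Ne, Submodule.Quotient.mk_eq_zero, mem_multiples_mk]
      exact c.not_dvd)⟩

/-- Every point is of the form `[F, G]`. -/
theorem Cone.mk'_surjective :
    Function.Surjective (Cone.mk' : Cone k N d₁ d₂ → Hbar k N d₁ d₂) := by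
  rintro ⟨x, y⟩
  induction x using Projectivization.ind with
  | h F hF =>
    induction y using Projectivization.ind with
    | h y hy =>
      obtain ⟨G, rfl⟩ := Submodule.Quotient.mk_surjective _ y
      refine ⟨⟨F, G, hF, fun h => hy ?_⟩, rfl⟩
      rw [Submodule.Quotient.mk_eq_zero, mem_multiples_mk]
      exact h

/-- The coefficients of a pair of polynomials along the monomials of degrees `d₁` and `d₂`. -/
def coordsOf (F G : MvPolynomial (Fin (N + 1)) k) : Mon N d₁ ⊕ Mon N d₂ → k :=
  Sum.elim (fun M => MvPolynomial.coeff M.1 F) (fun M => MvPolynomial.coeff M.1 G)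

/-- Affine coordinates of the pair `(F, G)`. -/
def Cone.coords (c : Cone k N d₁ d₂) : Mon N d₁ ⊕ Mon N d₂ → k :=
  coordsOf (c.F : MvPolynomial (Fin (N + 1)) k) (c.G : MvPolynomial (Fin (N + 1)) k)

/-- The Zariski topology on the set of points `[F, G]`. -/
instance : TopologicalSpace (Hbar k N d₁ d₂) := (zariski Cone.coords).coinduced Cone.mk'

/-- Regular functions on the variety of points `[F, G]`. -/
def Hbar.IsRegularAt (h : Hbar k N d₁ d₂ → k) (x : Hbar k N d₁ d₂) : Prop :=
  QuotientRegularAt Cone.coords Cone.mk' h x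

/-! ### The line bundles `𝒪(l₁, l₂)` -/

/-- Sections of `𝒪(l₁, l₂)` over `U`: regular functions `s(F, G)` on the pairs with
`[F, G] ∈ U` such that `s(a F, b G + K F) = a ^ l₁ * b ^ l₂ * s(F, G)`.
Here `𝒪(1, 0)` is the pull-back of `𝒪(1)` from the base, and `𝒪(0, 1)` is the relative `𝒪(1)`. The
values of `s` outside of the preimage of `U` are irrelevant. -/
structure IsSection (l : ℤ × ℤ) (U : Set (Hbar k N d₁ d₂)) (s : Cone k N d₁ d₂ → k) : Prop where
  regular : ∀ c : Cone k N d₁ d₂, c.mk' ∈ U → RegularAt Cone.coords s c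
  equivariant : ∀ (c c' : Cone k N d₁ d₂) (a b : kˣ) (K : Forms k N (d₂ - d₁)), c.mk' ∈ U →
    (c'.F : MvPolynomial (Fin (N + 1)) k) = (a : k) • (c.F : MvPolynomial (Fin (N + 1)) k) →
    (c'.G : MvPolynomial (Fin (N + 1)) k) =
      (b : k) • (c.G : MvPolynomial (Fin (N + 1)) k) + K * c.F →
    s c' = ((a ^ l.1 * b ^ l.2 : kˣ) : k) * s c

variable (k N d₁ d₂) in
/-- `𝒪(l₁, l₂)` is base-point free: for every point, some global section does not vanish there. -/
def BasePointFree (l : ℤ × ℤ) : Prop :=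
  ∀ x : Hbar k N d₁ d₂, ∃ s : Cone k N d₁ d₂ → k, IsSection l Set.univ s ∧
    ∃ c : Cone k N d₁ d₂, c.mk' = x ∧ s c ≠ 0

/-- A map to projective space is a closed immersion: a homeomorphism onto a closed subset such
that the regular functions at a point are exactly the pull-backs of regular functions. -/
def IsClosedImmersion {n : ℕ} (φ : Hbar k N d₁ d₂ → ProjSpace k n) : Prop :=
  Topology.IsClosedEmbedding φ ∧
    ∀ (x : Hbar k N d₁ d₂) (h : Hbar k N d₁ d₂ → k), Hbar.IsRegularAt h x ↔
      ∃ h' : ProjSpace k n → k, ProjSpace.IsRegularAt h' (φ x) ∧ ∀ᶠ y in 𝓝 x, h y = h' (φ y)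

variable (k N d₁ d₂) in
/-- `𝒪(l₁, l₂)` is very ample: finitely many global sections without common zeros define a closed
immersion to a projective space. -/
def VeryAmple (l : ℤ × ℤ) : Prop :=
  ∃ (n : ℕ) (s : Fin (n + 1) → Cone k N d₁ d₂ → k) (φ : Hbar k N d₁ d₂ → ProjSpace k n),
    (∀ i, IsSection l Set.univ (s i)) ∧
    (∀ c : Cone k N d₁ d₂, ∃ hc : (fun i => s i c) ≠ 0,
      φ c.mk' = Projectivization.mk k (fun i => s i c) hc) ∧
    IsClosedImmersion φ

variable (k N d₁ d₂) in
/-- `𝒪(l₁, l₂)` is ample: some power `𝒪(l₁, l₂)^{⊗ m} = 𝒪(m l₁, m l₂)`, `m ≥ 1`, is very ample. -/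
def Ample (l : ℤ × ℤ) : Prop :=
  ∃ m : ℕ, 1 ≤ m ∧ VeryAmple k N d₁ d₂ (m • l)

/-! ### Curves, degrees and nefness -/

/-- A curve: an irreducible closed subset of dimension `1`. -/
def IsCurve (C : Set (Hbar k N d₁ d₂)) : Prop :=
  IsClosed C ∧ IsIrreducible C ∧ topologicalKrullDim C = 1

/-- The local ring of the closed subvariety `C` at `p`: germs along `C` of regular functions. -/
def localRing (C : Set (Hbar k N d₁ d₂)) (p : Hbar k N d₁ d₂) :
    Subring (Filter.Germ (𝓝[C] p) k) where
  carrier := {g | ∃ h : Hbar k N d₁ d₂ → k, Hbar.IsRegularAt h p ∧ g = ↑h}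
  mul_mem' := by
    rintro _ _ ⟨h, hh, rfl⟩ ⟨h', hh', rfl⟩
    exact ⟨h * h', fun c hc => (hh c hc).mul (hh' c hc), rfl⟩
  one_mem' := ⟨1, fun c _ => RegularAt.const _ 1 c, rfl⟩
  add_mem' := by
    rintro _ _ ⟨h, hh, rfl⟩ ⟨h', hh', rfl⟩
    exact ⟨h + h', fun c hc => (hh c hc).add (hh' c hc), rfl⟩
  zero_mem' := ⟨0, fun c _ => RegularAt.const _ 0 c, rfl⟩
  neg_mem' := by
    rintro _ ⟨h, hh, rfl⟩
    refine ⟨fun x => -1 * h x, fun c hc => (RegularAt.const _ (-1) c).mul (hh c hc), ?_⟩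
    have : (fun x => -1 * h x) = -h := by
      funext x
      simp
    rw [this]
    rfl

/-- The ideal of the zero scheme of `s|_C` in the local ring of `C` at `p`, where `s` is a section
of `𝒪(l₁, l₂)`: it is generated by the functions `u s`, for `u` a local section of the dual line
bundle `𝒪(-l₁, -l₂)` near `p`. -/
def zeroIdeal (C : Set (Hbar k N d₁ d₂)) (p : Hbar k N d₁ d₂) (l : ℤ × ℤ)
    (s : Cone k N d₁ d₂ → k) : Ideal (localRing C p) :=
  Ideal.span {g | ∃ (U : Set (Hbar k N d₁ d₂)) (u : Cone k N d₁ d₂ → k) (h : Hbar k N d₁ d₂ → k),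
    IsOpen U ∧ p ∈ U ∧ IsSection (-l) U u ∧
    (∀ c : Cone k N d₁ d₂, c.mk' ∈ U → h c.mk' = u c * s c) ∧
    (g : Filter.Germ (𝓝[C] p) k) = ↑h}

/-- The number of zeros of `s|_C` on the curve `C`, counted with multiplicity, where the
multiplicity of a zero `p` is the length of the quotient of the local ring of `C` at `p` by the
local equation of `s|_C`. -/
def zeroCount (C : Set (Hbar k N d₁ d₂)) (l : ℤ × ℤ) (s : Cone k N d₁ d₂ → k) : ℕ :=
  ∑ᶠ p : C, (Module.length (localRing C p.1) (localRing C p.1 ⧸ zeroIdeal C p.1 l s)).toNat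

/-- `n` is the degree of `𝒪(l₁, l₂)` on the curve `C`: it is the number of zeros minus the number of
poles of a nonzero rational section `s / t` of `𝒪(l₁, l₂)|_C`, where `s` and `t` are global sections
of line bundles `𝒪(a)` and `𝒪(b)` with `a - b = (l₁, l₂)` that do not vanish identically on `C`. -/
def HasDegree (C : Set (Hbar k N d₁ d₂)) (l : ℤ × ℤ) (n : ℤ) : Prop :=
  ∃ (a b : ℤ × ℤ) (s t : Cone k N d₁ d₂ → k), a - b = l ∧
    IsSection a Set.univ s ∧ IsSection b Set.univ t ∧
    (∃ c : Cone k N d₁ d₂, c.mk' ∈ C ∧ s c ≠ 0) ∧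
    (∃ c : Cone k N d₁ d₂, c.mk' ∈ C ∧ t c ≠ 0) ∧
    n = (zeroCount C a s : ℤ) - (zeroCount C b t : ℤ)

variable (k N d₁ d₂) in
/-- `𝒪(l₁, l₂)` is nef: its degree on every curve is nonnegative. -/
def Nef (l : ℤ × ℤ) : Prop :=
  ∀ C : Set (Hbar k N d₁ d₂), IsCurve C → ∃ n : ℤ, HasDegree C l n ∧ 0 ≤ n

/-! ### Formal Euclidean division -/

variable (k N d₁ d₂) in
/-- The ring of polynomials in the indeterminate coefficients `f^{(M)}` and `g^{(M)}`. -/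
abbrev CoeffRing : Type _ := MvPolynomial (Mon N d₁ ⊕ Mon N d₂) k

variable (k N d₁ d₂) in
/-- The generic form `f = ∑ f^{(M)} M` of degree `d₁`. -/
def genericF : MvPolynomial (Fin (N + 1)) (CoeffRing k N d₁ d₂) :=
  ∑ M : Mon N d₁, MvPolynomial.monomial M.1 (MvPolynomial.X (Sum.inl M))

variable (k N d₁ d₂) in
/-- The generic form `g = ∑ g^{(M)} M` of degree `d₂`. -/
def genericG : MvPolynomial (Fin (N + 1)) (CoeffRing k N d₁ d₂) :=
  ∑ M : Mon N d₂, MvPolynomial.monomial M.1 (MvPolynomial.X (Sum.inr M))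

/-- The monomial `X₀ ^ d`. -/
def X0pow (N d : ℕ) : Mon N d := ⟨Finsupp.single 0 d, by
  simp [Finset.mem_finsuppAntidiag, Finsupp.single_apply]⟩

/-- `P` is homogeneous of degree `(x, y, z)` with respect to the variables `X₀, …, X_N`, the
indeterminates `f^{(M)}` and the indeterminates `g^{(M)}`. -/
def IsTrihomogeneous (P : MvPolynomial (Fin (N + 1)) (CoeffRing k N d₁ d₂)) (x y z : ℕ) : Prop :=
  P.IsHomogeneous x ∧ ∀ m : Fin (N + 1) →₀ ℕ, MvPolynomial.IsWeightedHomogeneous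
    (Sum.elim (fun _ => (1, 0)) (fun _ => (0, 1)) : Mon N d₁ ⊕ Mon N d₂ → ℕ × ℕ)
    (MvPolynomial.coeff m P) (y, z)

/-- `q` and `r` are the quotient and the remainder of the formal Euclidean division of `g` by `f`
with respect to `X₀`. -/
structure IsFormalDivision (q r : MvPolynomial (Fin (N + 1)) (CoeffRing k N d₁ d₂)) : Prop where
  quotient_hom : IsTrihomogeneous q (d₂ - d₁) (d₂ - d₁) 1
  remainder_hom : IsTrihomogeneous r d₂ (d₂ - d₁ + 1) 1
  reduced : ∀ m ∈ r.support, m 0 < d₁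
  identity : MvPolynomial.C (MvPolynomial.X (Sum.inl (X0pow N d₁))) ^ (d₂ - d₁ + 1) *
    genericG k N d₁ d₂ = q * genericF k N d₁ d₂ + r

/-- The linear change of coordinates `X_i ↦ ∑ j, γ i j X_j`. -/
def substitute (γ : GL (Fin (N + 1)) k) :
    MvPolynomial (Fin (N + 1)) k →ₐ[k] MvPolynomial (Fin (N + 1)) k :=
  MvPolynomial.aeval fun i => ∑ j, MvPolynomial.C (γ.1 i j) * MvPolynomial.X j

/-- The function `σ_M` in the coordinate system given by `γ`: the coefficient of the monomial `M`
in `r`, evaluated at the coefficients of `F` and `G` in that coordinate system. -/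
def remainderCoeff (r : MvPolynomial (Fin (N + 1)) (CoeffRing k N d₁ d₂))
    (γ : GL (Fin (N + 1)) k) (M : Mon N d₂) (c : Cone k N d₁ d₂) : k :=
  MvPolynomial.eval
    (coordsOf (substitute γ (c.F : MvPolynomial (Fin (N + 1)) k))
      (substitute γ (c.G : MvPolynomial (Fin (N + 1)) k)))
    (MvPolynomial.coeff M.1 r)

end Hbar

end CompleteIntersection

end

/-!
The base-point freeness of `𝒪(d₂ - d₁ + 1, 1)` comes from division with remainder. Dividing `G` by
`F` with respect to `X₀`, and multiplying by the coefficient `a` of `X₀ ^ d₁` in `F` at each of the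
`d₂ - d₁ + 1` steps instead of dividing by it, gives `a ^ (d₂ - d₁ + 1) G = q F + r` (`divStep`,
`divRem_identity`). The remainder is linear in `G`, of degree `d₂ - d₁ + 1` in `F`, and it vanishes
on the multiples of `F`, even where `a = 0` (`divRem_mul_self`). Hence its coefficients are sections
of `𝒪(d₂ - d₁ + 1, 1)` (`isSection_remainderCoeff`). In a coordinate system with `a ≠ 0`, which exists
since `k` is infinite, they vanish simultaneously only if `F ∣ G`
(`exists_remainderCoeff_ne_zero`).

Nonnegative combinations of the base-point free bundles `𝒪(1, 0)` and `𝒪(d₂ - d₁ + 1, 1)` are nef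
(`nef_of_eq`). That there are no other nef bundles is shown by two smooth rational curves.

* `fibreLine`: a line in the fibre over `X₀ ^ d₁`, on which `𝒪(l₁, l₂)` has degree `l₂`. It exists
  unless `N = d₁ = 1`, when the fibres are points.
* `pencil`: the pairs `(P L, P H)` with `P = X₀ ^ (d₁ - 1)`, where `L` runs through the linear forms
  in two variables and `H` is a form of degree `d₂ - d₁ + 1` in the same variables. Modulo `L`, the
  form `H` only matters through its value at the zero of `L`, so that the point depends on `L` alone.
  Here `𝒪(l₁, l₂)` has degree `l₁ - (d₂ - d₁ + 1) l₂`. All powers of `𝒪(d₂ - d₁ + 1, 1)` are trivial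
  on this curve, so their sections do not separate its points and the bundle is not ample.

To know that these degrees do not depend on the sections used to compute them, a smooth rational
curve is described by two charts (`RationalCurve`). Sections of line bundles restrict to polynomials
on the charts (`exists_polynomial_of_isSection`), the local rings consist of the quotients of
polynomials with nonvanishing denominator, and so the length counting the zeros of a section at a
point is the multiplicity of a root (`length_zeroIdeal`). The multiplicities add up to the degree
(`zeroCount_eq`).
-/

noncomputable section

open scoped Topology

namespace CompleteIntersection

/-! ### Euclidean division by a form with respect to `X₀` -/

section Division

open MvPolynomial

local infixl:70 " ⫽ " => MvPolynomial.divMonomial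

variable {S S' : Type*} [CommRing S] [CommRing S'] {N : ℕ}

/-- All monomials of `P` have `X₀`-exponent less than `n`. -/
def LowX₀ (n : ℕ) (P : MvPolynomial (Fin (N + 1)) S) : Prop :=
  ∀ m : Fin (N + 1) →₀ ℕ, n ≤ m 0 → coeff m P = 0

theorem LowX₀.mul {a b c : ℕ} {P Q : MvPolynomial (Fin (N + 1)) S} (hP : LowX₀ a P)
    (hQ : LowX₀ b Q) (h : a + b ≤ c + 1) : LowX₀ c (P * Q) := by
  classical
  intro m hm
  rw [coeff_mul]
  refine Finset.sum_eq_zero fun x hx => ?_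
  rw [Finset.HasAntidiagonal.mem_antidiagonal] at hx
  have h0 : x.1 0 + x.2 0 = m 0 := by rw [← hx]; rfl
  by_cases h1 : a ≤ x.1 0
  · rw [hP _ h1, zero_mul]
  · rw [hQ x.2 (by omega), mul_zero]

theorem LowX₀.add {a : ℕ} {P Q : MvPolynomial (Fin (N + 1)) S} (hP : LowX₀ a P)
    (hQ : LowX₀ a Q) : LowX₀ a (P + Q) := fun m hm => by
  rw [coeff_add, hP m hm, hQ m hm, add_zero]

theorem LowX₀.neg {a : ℕ} {P : MvPolynomial (Fin (N + 1)) S} (hP : LowX₀ a P) :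
    LowX₀ a (-P) := fun m hm => by
  rw [coeff_neg, hP m hm, neg_zero]

theorem LowX₀.C_mul {a : ℕ} {P : MvPolynomial (Fin (N + 1)) S} (hP : LowX₀ a P) (x : S) :
    LowX₀ a (C x * P) := fun m hm => by
  rw [coeff_C_mul, hP m hm, mul_zero]

theorem LowX₀.mono {a b : ℕ} {P : MvPolynomial (Fin (N + 1)) S} (hP : LowX₀ a P)
    (h : a ≤ b) : LowX₀ b P := fun m hm => hP m (h.trans hm)

theorem LowX₀.eq_zero {P : MvPolynomial (Fin (N + 1)) S} (hP : LowX₀ 0 P) : P = 0 := by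
  ext m
  rw [hP m (Nat.zero_le _), coeff_zero]

theorem LowX₀.of_isHomogeneous {d : ℕ} {P : MvPolynomial (Fin (N + 1)) S}
    (hP : P.IsHomogeneous d) : LowX₀ (d + 1) P := fun m hm => by
  refine hP.coeff_eq_zero (fun h => ?_)
  have := Finsupp.le_degree 0 m
  omega

theorem LowX₀.divMonomial {d n : ℕ} {P : MvPolynomial (Fin (N + 1)) S}
    (hP : LowX₀ (d + n) P) : LowX₀ n (P ⫽ Finsupp.single 0 d) := fun m hm => by
  rw [coeff_divMonomial]
  exact hP _ (by simpa using hm)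

theorem LowX₀.divMonomial_eq_zero {d : ℕ} {P : MvPolynomial (Fin (N + 1)) S}
    (hP : LowX₀ d P) : P ⫽ Finsupp.single 0 d = 0 :=
  (LowX₀.divMonomial (n := 0) hP).eq_zero

theorem lowX₀_modMonomial (d : ℕ) (P : MvPolynomial (Fin (N + 1)) S) :
    LowX₀ d (P.modMonomial (Finsupp.single 0 d)) := fun m hm => by
  refine coeff_modMonomial_of_le _ ?_
  intro i
  by_cases hi : i = 0
  · subst hi; simpa using hm
  · simp [Finsupp.single_eq_of_ne hi]

theorem C_mul_divMonomial (a : S) (P : MvPolynomial (Fin (N + 1)) S) (s : Fin (N + 1) →₀ ℕ) :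
    (C a * P) ⫽ s = C a * (P ⫽ s) := by
  ext m
  simp [coeff_divMonomial, coeff_C_mul]

theorem map_divMonomial (φ : S →+* S') (P : MvPolynomial (Fin (N + 1)) S)
    (s : Fin (N + 1) →₀ ℕ) : map φ (P ⫽ s) = map φ P ⫽ s := by
  ext m
  simp [coeff_divMonomial, coeff_map]

theorem isHomogeneous_divMonomial {d e : ℕ} {P : MvPolynomial (Fin (N + 1)) S}
    (hP : P.IsHomogeneous (d + e)) :
    (P ⫽ Finsupp.single 0 d).IsHomogeneous e := by
  intro m hm
  rw [coeff_divMonomial] at hm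
  have := hP hm
  rw [map_add, Finsupp.weight_single] at this
  simpa using this

/-- The only monomial of a form of degree `d` divisible by `X₀ ^ d` is `X₀ ^ d` itself. -/
theorem exists_eq_leading_add_low {d : ℕ} {F : MvPolynomial (Fin (N + 1)) S}
    (hF : F.IsHomogeneous d) :
    ∃ F', LowX₀ d F' ∧
      F = monomial (Finsupp.single 0 d) 1 * C (coeff (Finsupp.single 0 d) F) + F' := by
  refine ⟨F.modMonomial (Finsupp.single 0 d), lowX₀_modMonomial d F, ?_⟩
  conv_lhs => rw [← divMonomial_add_modMonomial F (Finsupp.single 0 d)]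
  congr 2
  have h0 : (F ⫽ Finsupp.single 0 d).IsHomogeneous 0 := isHomogeneous_divMonomial hF
  ext m
  by_cases hm : m = 0
  · subst hm; simp [coeff_divMonomial]
  · rw [h0.coeff_eq_zero (mt (Finsupp.degree_eq_zero_iff m).1 hm), coeff_C, if_neg (Ne.symm hm)]

/-- One step of the division of `G` by `F` with respect to `X₀`: with `a` the coefficient of
`X₀ ^ d` in `F`, subtract from `a G` the multiple of `F` that cancels all monomials of `G` divisible
by `X₀ ^ d`, at the cost of monomials with smaller `X₀`-exponent. No division by `a` takes place,
so that the process makes sense for `a = 0`. -/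
def divStep (d : ℕ) (F G : MvPolynomial (Fin (N + 1)) S) : MvPolynomial (Fin (N + 1)) S :=
  C (coeff (Finsupp.single 0 d) F) * G - (G ⫽ Finsupp.single 0 d) * F

/-- The remainder of the division of `G` by `F` after `n` steps. -/
def divRem (d : ℕ) (F : MvPolynomial (Fin (N + 1)) S) :
    ℕ → MvPolynomial (Fin (N + 1)) S → MvPolynomial (Fin (N + 1)) S
  | 0, G => G
  | n + 1, G => divRem d F n (divStep d F G)

/-- The quotient of the division of `G` by `F` after `n` steps. -/
def divQuo (d : ℕ) (F : MvPolynomial (Fin (N + 1)) S) :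
    ℕ → MvPolynomial (Fin (N + 1)) S → MvPolynomial (Fin (N + 1)) S
  | 0, _ => 0
  | n + 1, G => divQuo d F n (divStep d F G) +
      C (coeff (Finsupp.single 0 d) F) ^ n * (G ⫽ Finsupp.single 0 d)

theorem divRem_identity (d : ℕ) (F : MvPolynomial (Fin (N + 1)) S) (n : ℕ)
    (G : MvPolynomial (Fin (N + 1)) S) :
    C (coeff (Finsupp.single 0 d) F) ^ n * G = divQuo d F n G * F + divRem d F n G := by
  induction n generalizing G with
  | zero => simp [divQuo, divRem]
  | succ n ih =>
    have := ih (divStep d F G)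
    rw [divQuo, divRem, add_mul, add_right_comm, ← this, divStep]
    ring

theorem LowX₀.divStep {d n : ℕ} {F G : MvPolynomial (Fin (N + 1)) S} (hF : F.IsHomogeneous d)
    (hG : LowX₀ (d + (n + 1)) G) : LowX₀ (d + n) (divStep d F G) := by
  obtain ⟨F', hF', hFF'⟩ := exists_eq_leading_add_low hF
  have hG' := divMonomial_add_modMonomial G (Finsupp.single 0 d)
  set a := coeff (Finsupp.single 0 d) F
  set T := G ⫽ Finsupp.single 0 d with hT
  set R := G.modMonomial (Finsupp.single 0 d)
  have key : CompleteIntersection.divStep d F G = C a * R + -(T * F') := by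
    unfold CompleteIntersection.divStep
    change C a * G - T * F = _
    rw [hFF', ← hG']
    ring
  rw [key]
  exact (((lowX₀_modMonomial d G).mono (Nat.le_add_right d n)).C_mul a).add
    ((LowX₀.divMonomial hG).mul hF' (by omega)).neg

theorem LowX₀.divRem {d n : ℕ} {F G : MvPolynomial (Fin (N + 1)) S} (hF : F.IsHomogeneous d)
    (hG : LowX₀ (d + n) G) : LowX₀ d (divRem d F n G) := by
  induction n generalizing G with
  | zero => exact hG
  | succ n ih => exact ih (LowX₀.divStep hF hG)

/-- The division step maps multiples of `F` to multiples of `F` whose cofactor has smaller degree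
in `X₀`. -/
theorem exists_divStep_mul_eq {d n : ℕ} {F K : MvPolynomial (Fin (N + 1)) S}
    (hF : F.IsHomogeneous d) (hK : LowX₀ (n + 1) K) :
    ∃ K', LowX₀ n K' ∧ divStep d F (K * F) = K' * F := by
  obtain ⟨F', hF', hFF'⟩ := exists_eq_leading_add_low hF
  refine ⟨-((K * F') ⫽ Finsupp.single 0 d),
    (LowX₀.divMonomial (hK.mul hF' (by omega))).neg, ?_⟩
  have h : (K * F) ⫽ Finsupp.single 0 d =
      C (coeff (Finsupp.single 0 d) F) * K + (K * F') ⫽ Finsupp.single 0 d := by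
    conv_lhs => rw [hFF', mul_add, add_divMonomial, mul_left_comm, divMonomial_monomial_mul,
      mul_comm K]
  rw [divStep, h]
  ring

theorem divRem_mul_self {d n : ℕ} {F K : MvPolynomial (Fin (N + 1)) S}
    (hF : F.IsHomogeneous d) (hK : LowX₀ n K) : divRem d F n (K * F) = 0 := by
  induction n generalizing K with
  | zero => rw [hK.eq_zero, zero_mul, divRem]
  | succ n ih =>
    obtain ⟨K', hK', h⟩ := exists_divStep_mul_eq hF hK
    rw [divRem, h, ih hK']

theorem divRem_add (d : ℕ) (F : MvPolynomial (Fin (N + 1)) S) (n : ℕ)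
    (G G' : MvPolynomial (Fin (N + 1)) S) :
    divRem d F n (G + G') = divRem d F n G + divRem d F n G' := by
  induction n generalizing G G' with
  | zero => rfl
  | succ n ih =>
    rw [divRem, divRem, divRem, ← ih]
    congr 1
    rw [divStep, divStep, divStep, add_divMonomial]
    ring

theorem divRem_C_mul (d : ℕ) (F : MvPolynomial (Fin (N + 1)) S) (n : ℕ) (b : S)
    (G : MvPolynomial (Fin (N + 1)) S) :
    divRem d F n (C b * G) = C b * divRem d F n G := by
  induction n generalizing G with
  | zero => rfl
  | succ n ih =>
    rw [divRem, divRem, ← ih]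
    congr 1
    rw [divStep, divStep, C_mul_divMonomial]
    ring

theorem divRem_C_mul_left (d : ℕ) (F : MvPolynomial (Fin (N + 1)) S) (n : ℕ) (a : S)
    (G : MvPolynomial (Fin (N + 1)) S) :
    divRem d (C a * F) n G = C (a ^ n) * divRem d F n G := by
  induction n generalizing G with
  | zero => simp [divRem]
  | succ n ih =>
    have : divStep d (C a * F) G = C a * divStep d F G := by
      rw [divStep, divStep, coeff_C_mul, C_mul]
      ring
    rw [divRem, divRem, this, ih, divRem_C_mul, pow_succ, C_mul, mul_assoc]

/-- A reduced form is its own remainder, up to a power of the leading coefficient. -/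
theorem divRem_of_low {d n : ℕ} {F G : MvPolynomial (Fin (N + 1)) S} (hG : LowX₀ d G) :
    divRem d F n G = C (coeff (Finsupp.single 0 d) F ^ n) * G := by
  induction n generalizing G with
  | zero => simp [divRem]
  | succ n ih =>
    rw [divRem, divStep, hG.divMonomial_eq_zero, zero_mul, sub_zero, divRem_C_mul, ih hG,
      pow_succ, C_mul]
    ring

theorem map_divRem (φ : S →+* S') (d : ℕ) (F : MvPolynomial (Fin (N + 1)) S) (n : ℕ)
    (G : MvPolynomial (Fin (N + 1)) S) :
    map φ (divRem d F n G) = divRem d (map φ F) n (map φ G) := by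
  induction n generalizing G with
  | zero => rfl
  | succ n ih =>
    rw [divRem, divRem, ih]
    congr 1
    rw [divStep, divStep, map_sub, map_mul, map_mul, map_C, map_divMonomial, coeff_map]

theorem isHomogeneous_divRem {d e n : ℕ} (hd : d ≤ e) {F G : MvPolynomial (Fin (N + 1)) S}
    (hF : F.IsHomogeneous d) (hG : G.IsHomogeneous e) : (divRem d F n G).IsHomogeneous e := by
  obtain ⟨e, rfl⟩ := Nat.exists_eq_add_of_le hd
  induction n generalizing G with
  | zero => exact hG
  | succ n ih =>
    refine ih ((hG.C_mul _).sub ?_)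
    rw [add_comm d e]
    exact (isHomogeneous_divMonomial hG).mul hF

end Division

/-! ### The generic forms and their division -/

section Generic

open MvPolynomial

local infixl:70 " ⫽ " => MvPolynomial.divMonomial

variable {k : Type*} [Field k] {N d₁ d₂ : ℕ}

theorem mem_mon_iff {d : ℕ} (m : Fin (N + 1) →₀ ℕ) :
    m ∈ Finset.finsuppAntidiag (Finset.univ : Finset (Fin (N + 1))) d ↔ m.degree = d := by
  rw [Finset.mem_finsuppAntidiag, Finsupp.degree_eq_sum]
  simp

theorem IsTrihomogeneous.mul {P Q : MvPolynomial (Fin (N + 1)) (CoeffRing k N d₁ d₂)}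
    {x y z x' y' z' : ℕ} (hP : IsTrihomogeneous P x y z) (hQ : IsTrihomogeneous Q x' y' z') :
    IsTrihomogeneous (P * Q) (x + x') (y + y') (z + z') := by
  classical
  refine ⟨hP.1.mul hQ.1, fun m => ?_⟩
  rw [coeff_mul]
  exact IsWeightedHomogeneous.sum _ _ _ fun i _ => (hP.2 i.1).mul (hQ.2 i.2)

theorem IsTrihomogeneous.add {P Q : MvPolynomial (Fin (N + 1)) (CoeffRing k N d₁ d₂)}
    {x y z : ℕ} (hP : IsTrihomogeneous P x y z) (hQ : IsTrihomogeneous Q x y z) :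
    IsTrihomogeneous (P + Q) x y z :=
  ⟨hP.1.add hQ.1, fun m => by rw [coeff_add]; exact (hP.2 m).add (hQ.2 m)⟩

theorem IsTrihomogeneous.neg {P : MvPolynomial (Fin (N + 1)) (CoeffRing k N d₁ d₂)}
    {x y z : ℕ} (hP : IsTrihomogeneous P x y z) : IsTrihomogeneous (-P) x y z :=
  ⟨hP.1.neg, fun m => by
    rw [coeff_neg, ← neg_one_smul k]
    exact (weightedHomogeneousSubmodule k _ _).smul_mem _ (hP.2 m)⟩

theorem isTrihomogeneous_C {a : CoeffRing k N d₁ d₂} {y z : ℕ}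
    (ha : IsWeightedHomogeneous
      (Sum.elim (fun _ => (1, 0)) (fun _ => (0, 1)) : Mon N d₁ ⊕ Mon N d₂ → ℕ × ℕ) a (y, z)) :
    IsTrihomogeneous (C a : MvPolynomial (Fin (N + 1)) (CoeffRing k N d₁ d₂)) 0 y z := by
  classical
  refine ⟨isHomogeneous_C _ _, fun m => ?_⟩
  rw [coeff_C]
  split_ifs
  · exact ha
  · exact isWeightedHomogeneous_zero _ _ _

theorem coeff_genericF (m : Fin (N + 1) →₀ ℕ) (hm : m.degree = d₁) :
    coeff m (genericF k N d₁ d₂) = X (Sum.inl ⟨m, (mem_mon_iff m).2 hm⟩) := by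
  classical
  rw [genericF, coeff_sum, Finset.sum_eq_single ⟨m, (mem_mon_iff m).2 hm⟩]
  · simp [coeff_monomial]
  · rintro ⟨m', hm'⟩ _ hne
    rw [coeff_monomial, if_neg (fun h => hne (Subtype.ext h))]
  · simp

theorem coeff_genericG (m : Fin (N + 1) →₀ ℕ) (hm : m.degree = d₂) :
    coeff m (genericG k N d₁ d₂) = X (Sum.inr ⟨m, (mem_mon_iff m).2 hm⟩) := by
  classical
  rw [genericG, coeff_sum, Finset.sum_eq_single ⟨m, (mem_mon_iff m).2 hm⟩]
  · simp [coeff_monomial]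
  · rintro ⟨m', hm'⟩ _ hne
    rw [coeff_monomial, if_neg (fun h => hne (Subtype.ext h))]
  · simp

variable (k N d₁ d₂) in
theorem isTrihomogeneous_genericF : IsTrihomogeneous (genericF k N d₁ d₂) d₁ 1 0 := by
  have h : (genericF k N d₁ d₂).IsHomogeneous d₁ :=
    IsHomogeneous.sum _ _ _ fun M _ => isHomogeneous_monomial _ ((mem_mon_iff _).1 M.2)
  refine ⟨h, fun m => ?_⟩
  by_cases hm : m.degree = d₁
  · rw [coeff_genericF m hm]
    exact isWeightedHomogeneous_X _ _ _
  · rw [h.coeff_eq_zero hm]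
    exact isWeightedHomogeneous_zero _ _ _

variable (k N d₁ d₂) in
theorem isTrihomogeneous_genericG : IsTrihomogeneous (genericG k N d₁ d₂) d₂ 0 1 := by
  have h : (genericG k N d₁ d₂).IsHomogeneous d₂ :=
    IsHomogeneous.sum _ _ _ fun M _ => isHomogeneous_monomial _ ((mem_mon_iff _).1 M.2)
  refine ⟨h, fun m => ?_⟩
  by_cases hm : m.degree = d₂
  · rw [coeff_genericG m hm]
    exact isWeightedHomogeneous_X _ _ _
  · rw [h.coeff_eq_zero hm]
    exact isWeightedHomogeneous_zero _ _ _

theorem IsTrihomogeneous.divMonomial {P : MvPolynomial (Fin (N + 1)) (CoeffRing k N d₁ d₂)}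
    {d e y z : ℕ} (hP : IsTrihomogeneous P (d + e) y z) :
    IsTrihomogeneous (P ⫽ Finsupp.single 0 d) e y z :=
  ⟨isHomogeneous_divMonomial hP.1, fun m => by rw [coeff_divMonomial]; exact hP.2 _⟩

variable (k N d₁ d₂) in
theorem isTrihomogeneous_leadingCoeff :
    IsTrihomogeneous (C (coeff (Finsupp.single 0 d₁) (genericF k N d₁ d₂)) :
      MvPolynomial (Fin (N + 1)) (CoeffRing k N d₁ d₂)) 0 1 0 :=
  isTrihomogeneous_C ((isTrihomogeneous_genericF k N d₁ d₂).2 _)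

variable (k N d₁ d₂) in
theorem isTrihomogeneous_leadingCoeff_pow (n : ℕ) :
    IsTrihomogeneous (C (coeff (Finsupp.single 0 d₁) (genericF k N d₁ d₂)) ^ n :
      MvPolynomial (Fin (N + 1)) (CoeffRing k N d₁ d₂)) 0 n 0 := by
  induction n with
  | zero =>
    rw [pow_zero, ← C_1]
    exact isTrihomogeneous_C (isWeightedHomogeneous_one _ _)
  | succ n ih =>
    rw [pow_succ]
    exact ih.mul (isTrihomogeneous_leadingCoeff k N d₁ d₂)

theorem IsTrihomogeneous.divStep {G : MvPolynomial (Fin (N + 1)) (CoeffRing k N d₁ d₂)}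
    {e y z : ℕ} (hG : IsTrihomogeneous G (d₁ + e) y z) :
    IsTrihomogeneous (divStep d₁ (genericF k N d₁ d₂) G) (d₁ + e) (y + 1) z := by
  have h1 := (isTrihomogeneous_leadingCoeff k N d₁ d₂).mul hG
  have h2 := hG.divMonomial.mul (isTrihomogeneous_genericF k N d₁ d₂)
  rw [zero_add, zero_add, add_comm 1 y] at h1
  rw [add_zero, add_comm e] at h2
  rw [CompleteIntersection.divStep, sub_eq_add_neg]
  exact h1.add h2.neg

theorem IsTrihomogeneous.divRem {G : MvPolynomial (Fin (N + 1)) (CoeffRing k N d₁ d₂)}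
    {e y z : ℕ} (n : ℕ) (hG : IsTrihomogeneous G (d₁ + e) y z) :
    IsTrihomogeneous (divRem d₁ (genericF k N d₁ d₂) n G) (d₁ + e) (y + n) z := by
  induction n generalizing G y with
  | zero => exact hG
  | succ n ih =>
    have := ih hG.divStep
    rwa [add_assoc, add_comm 1 n] at this

theorem IsTrihomogeneous.divQuo {G : MvPolynomial (Fin (N + 1)) (CoeffRing k N d₁ d₂)}
    {e y z : ℕ} (n : ℕ) (hG : IsTrihomogeneous G (d₁ + e) y z) :
    IsTrihomogeneous (divQuo d₁ (genericF k N d₁ d₂) (n + 1) G) e (y + n) z := by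
  induction n generalizing G y with
  | zero =>
    rw [CompleteIntersection.divQuo, CompleteIntersection.divQuo, zero_add, pow_zero, one_mul]
    exact hG.divMonomial
  | succ n ih =>
    rw [CompleteIntersection.divQuo]
    have h1 := ih hG.divStep
    have h2 := (isTrihomogeneous_leadingCoeff_pow k N d₁ d₂ (n + 1)).mul hG.divMonomial
    rw [add_assoc, add_comm 1 n] at h1
    rw [zero_add, zero_add, add_comm _ y] at h2
    exact h1.add h2

variable (k N d₁ d₂) in
/-- The remainder of the division of the generic form of degree `d₂` by the generic form of
degree `d₁`. -/
def genericRem : MvPolynomial (Fin (N + 1)) (CoeffRing k N d₁ d₂) :=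
  divRem d₁ (genericF k N d₁ d₂) (d₂ - d₁ + 1) (genericG k N d₁ d₂)

variable (k N) in
theorem isFormalDivision_genericRem (hd : d₁ ≤ d₂) :
    IsFormalDivision (divQuo d₁ (genericF k N d₁ d₂) (d₂ - d₁ + 1) (genericG k N d₁ d₂))
      (genericRem k N d₁ d₂) := by
  obtain ⟨e, rfl⟩ := Nat.exists_eq_add_of_le hd
  have hg := isTrihomogeneous_genericG k N d₁ (d₁ + e)
  have hq := hg.divQuo e
  have hr := hg.divRem (e + 1)
  rw [zero_add] at hq hr
  have he : d₁ + e - d₁ = e := Nat.add_sub_cancel_left d₁ e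
  refine ⟨by rw [he]; exact hq, by rw [genericRem, he]; exact hr, fun m hm => ?_, ?_⟩
  · by_contra h
    refine (mem_support_iff.1 hm) ?_
    rw [genericRem, he]
    exact LowX₀.divRem (isTrihomogeneous_genericF k N d₁ (d₁ + e)).1
      ((LowX₀.of_isHomogeneous hg.1).mono (by omega)) m (not_lt.1 h)
  · rw [genericRem, ← divRem_identity, coeff_genericF _ (by simp)]
    rfl

theorem map_genericF {F G : MvPolynomial (Fin (N + 1)) k} (hF : F.IsHomogeneous d₁) :
    map (eval (coordsOf F G)) (genericF k N d₁ d₂) = F := by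
  ext m
  rw [coeff_map]
  by_cases hm : m.degree = d₁
  · rw [coeff_genericF m hm, eval_X]
    rfl
  · rw [(isTrihomogeneous_genericF k N d₁ d₂).1.coeff_eq_zero hm, hF.coeff_eq_zero hm, map_zero]

theorem map_genericG {F G : MvPolynomial (Fin (N + 1)) k} (hG : G.IsHomogeneous d₂) :
    map (eval (coordsOf F G)) (genericG k N d₁ d₂) = G := by
  ext m
  rw [coeff_map]
  by_cases hm : m.degree = d₂
  · rw [coeff_genericG m hm, eval_X]
    rfl
  · rw [(isTrihomogeneous_genericG k N d₁ d₂).1.coeff_eq_zero hm, hG.coeff_eq_zero hm, map_zero]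

/-- Evaluating the generic remainder at the coefficients of `F` and `G` performs the division
of `G` by `F`. -/
theorem eval_coeff_genericRem {F G : MvPolynomial (Fin (N + 1)) k} (hF : F.IsHomogeneous d₁)
    (hG : G.IsHomogeneous d₂) (m : Fin (N + 1) →₀ ℕ) :
    eval (coordsOf F G) (coeff m (genericRem k N d₁ d₂)) =
      coeff m (divRem d₁ F (d₂ - d₁ + 1) G) := by
  rw [← coeff_map, genericRem, map_divRem, map_genericF hF, map_genericG hG]

end Generic

/-! ### Points, regular functions and sections -/

section Sections

open MvPolynomial

variable {k : Type*} [Field k] {N d₁ d₂ : ℕ}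

theorem RegularAt.of_eval {ι T : Type*} {coords : T → ι → k} (p : MvPolynomial ι k) (t : T) :
    RegularAt coords (fun t' => eval (coords t') p) t :=
  ⟨p, 1, by simp, fun t' _ => by simp⟩

theorem RegularAt.inv {ι T : Type*} {coords : T → ι → k} {s : T → k} {t : T}
    (h : RegularAt coords s t) (ht : s t ≠ 0) : RegularAt coords (fun x => (s x)⁻¹) t := by
  obtain ⟨p, q, hq, H⟩ := h
  have hp : eval (coords t) p ≠ 0 := fun h0 => ht (by rw [H t hq, h0, zero_div])
  refine ⟨q * q, p * q, by simp [hp, hq], fun t' ht' => ?_⟩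
  rw [map_mul] at ht'
  have h2 := right_ne_zero_of_mul ht'
  simp only [H t' h2, map_mul, inv_div, mul_div_mul_right _ _ h2]

/-- Regularity at `t` only depends on the values on a basic neighbourhood of `t`. -/
theorem RegularAt.congr {ι T : Type*} {coords : T → ι → k} {s s' : T → k} {t : T}
    (h : RegularAt coords s t) (p₀ : MvPolynomial ι k) (h₀ : eval (coords t) p₀ ≠ 0)
    (hs : ∀ t', eval (coords t') p₀ ≠ 0 → s' t' = s t') : RegularAt coords s' t := by
  obtain ⟨p, q, hq, H⟩ := h
  refine ⟨p * p₀, q * p₀, by simp [hq, h₀], fun t' ht' => ?_⟩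
  rw [map_mul] at ht'
  have h1 := left_ne_zero_of_mul ht'
  have h2 := right_ne_zero_of_mul ht'
  rw [hs t' h2, H t' h1, map_mul, map_mul, mul_div_mul_right _ _ h2]

theorem isTopologicalBasis_zariski {ι T : Type*} (coords : T → ι → k) :
    @TopologicalSpace.IsTopologicalBasis T (zariski coords)
      {D | ∃ p : MvPolynomial ι k, D = {t | eval (coords t) p ≠ 0}} := by
  let _ := zariski coords
  refine ⟨?_, ?_, rfl⟩
  · rintro _ ⟨p, rfl⟩ _ ⟨q, rfl⟩ t ⟨h1, h2⟩
    refine ⟨_, ⟨p * q, rfl⟩, ?_, ?_⟩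
    · rw [Set.mem_ofPred_eq, map_mul]
      exact mul_ne_zero h1 h2
    · intro t' ht'
      rw [Set.mem_ofPred_eq, map_mul] at ht'
      exact ⟨left_ne_zero_of_mul ht', right_ne_zero_of_mul ht'⟩
  · refine Set.eq_univ_of_forall fun t => ⟨_, ⟨1, rfl⟩, ?_⟩
    simp

theorem isOpen_zariski_iff {ι T : Type*} (coords : T → ι → k) (U : Set T) :
    @IsOpen T (zariski coords) U ↔ ∀ t ∈ U, ∃ p : MvPolynomial ι k, eval (coords t) p ≠ 0 ∧
      ∀ t', eval (coords t') p ≠ 0 → t' ∈ U := by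
  let _ := zariski coords
  rw [(isTopologicalBasis_zariski coords).isOpen_iff]
  constructor
  · intro h t ht
    obtain ⟨_, ⟨p, rfl⟩, h1, h2⟩ := h t ht
    exact ⟨p, h1, fun t' ht' => h2 ht'⟩
  · intro h t ht
    obtain ⟨p, h1, h2⟩ := h t ht
    exact ⟨_, ⟨p, rfl⟩, h1, fun t' ht' => h2 t' ht'⟩

theorem Hbar.isOpen_iff (U : Set (Hbar k N d₁ d₂)) :
    IsOpen U ↔ ∀ c : Cone k N d₁ d₂, c.mk' ∈ U →
      ∃ p : CoeffRing k N d₁ d₂, eval c.coords p ≠ 0 ∧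
        ∀ c' : Cone k N d₁ d₂, eval c'.coords p ≠ 0 → c'.mk' ∈ U := by
  rw [isOpen_coinduced, isOpen_zariski_iff]
  rfl

theorem homogeneousComponent_mul_of_isHomogeneous {σ : Type*} {P F : MvPolynomial σ k} {d e : ℕ}
    (hF : F.IsHomogeneous d) :
    homogeneousComponent (e + d) (P * F) = homogeneousComponent e P * F := by
  let _ := gradedAlgebra (σ := σ) (R := k)
  have h := DirectSum.coe_decompose_mul_of_right_mem_of_le (homogeneousSubmodule σ k)
    (a := P) (n := e + d) ((mem_homogeneousSubmodule d F).2 hF) (Nat.le_add_left d e)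
  rw [Nat.add_sub_cancel] at h
  rw [← decomposition.decompose'_apply, ← decomposition.decompose'_apply]
  exact h

theorem exists_form_of_dvd (hd : d₁ ≤ d₂) {F G : MvPolynomial (Fin (N + 1)) k}
    (hF : F.IsHomogeneous d₁) (hG : G.IsHomogeneous d₂) (h : F ∣ G) :
    ∃ K : Forms k N (d₂ - d₁), G = K * F := by
  obtain ⟨P, rfl⟩ := h
  refine ⟨⟨homogeneousComponent (d₂ - d₁) P, homogeneousComponent_mem _ _⟩, ?_⟩
  rw [← homogeneousComponent_mul_of_isHomogeneous hF, Nat.sub_add_cancel hd, mul_comm P]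
  exact (homogeneousComponent_eq_self hG).symm

theorem Hbar.mk_eq_mk_iff {x x' : Projectivization k (Forms k N d₁)} (hx : x = x')
    {G G' : Forms k N d₂} (hG : (Submodule.Quotient.mk G : _ ⧸ multiples x d₂) ≠ 0)
    (hG' : (Submodule.Quotient.mk G' : _ ⧸ multiples x' d₂) ≠ 0) :
    (⟨x, Projectivization.mk k _ hG⟩ : Hbar k N d₁ d₂) = ⟨x', Projectivization.mk k _ hG'⟩ ↔
      ∃ b : kˣ, G' - (b : k) • G ∈ multiples x d₂ := by
  subst hx
  rw [eq_comm, Sigma.mk.inj_iff, heq_eq_eq, Projectivization.mk_eq_mk_iff]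
  simp only [true_and]
  refine exists_congr fun b => ?_
  rw [← (Submodule.Quotient.eq (multiples x d₂)), Submodule.Quotient.mk_smul, eq_comm]
  rfl

/-- Two pairs define the same point exactly if they are related by the action defining
`𝒪(l₁, l₂)`. -/
theorem Cone.mk'_eq_iff (hd : d₁ ≤ d₂) (c c' : Cone k N d₁ d₂) :
    c.mk' = c'.mk' ↔ ∃ (a b : kˣ) (K : Forms k N (d₂ - d₁)),
      (c'.F : MvPolynomial (Fin (N + 1)) k) = (a : k) • (c.F : MvPolynomial (Fin (N + 1)) k) ∧
      (c'.G : MvPolynomial (Fin (N + 1)) k) =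
        (b : k) • (c.G : MvPolynomial (Fin (N + 1)) k) + K * c.F := by
  have hx : Projectivization.mk k c.F c.F_ne = Projectivization.mk k c'.F c'.F_ne ↔
      ∃ a : kˣ, (c'.F : MvPolynomial (Fin (N + 1)) k) =
        (a : k) • (c.F : MvPolynomial (Fin (N + 1)) k) := by
    rw [eq_comm, Projectivization.mk_eq_mk_iff]
    refine exists_congr fun a => ?_
    rw [eq_comm, Subtype.ext_iff]
    rfl
  have hb : ∀ b : kˣ, (c'.G - (b : k) • c.G ∈ multiples (Projectivization.mk k c.F c.F_ne) d₂ ↔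
      ∃ K : Forms k N (d₂ - d₁), (c'.G : MvPolynomial (Fin (N + 1)) k) =
        (b : k) • (c.G : MvPolynomial (Fin (N + 1)) k) + K * c.F) := by
    intro b
    rw [mem_multiples_mk]
    constructor
    · intro h
      obtain ⟨K, hK⟩ := exists_form_of_dvd hd c.F.2 (c'.G - (b : k) • c.G).2 h
      exact ⟨K, by rw [← hK, Submodule.coe_sub, Submodule.coe_smul]; ring⟩
    · rintro ⟨K, hK⟩
      exact ⟨K, by rw [Submodule.coe_sub, Submodule.coe_smul, hK]; ring⟩
  constructor
  · intro h
    have h1 := congrArg Sigma.fst h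
    obtain ⟨a, ha⟩ := hx.1 h1
    obtain ⟨b, hb'⟩ := (Hbar.mk_eq_mk_iff h1 _ _).1 h
    obtain ⟨K, hK⟩ := (hb b).1 hb'
    exact ⟨a, b, K, ha, hK⟩
  · rintro ⟨a, b, K, ha, hK⟩
    exact (Hbar.mk_eq_mk_iff (hx.2 ⟨a, ha⟩) _ _).2 ⟨b, (hb b).2 ⟨K, hK⟩⟩

theorem Cone.mk'_eq_of_dvd (hd : d₁ ≤ d₂) {c c' : Cone k N d₁ d₂} {a b : k} (ha : a ≠ 0)
    (hb : b ≠ 0)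
    (hF : (c'.F : MvPolynomial (Fin (N + 1)) k) = a • (c.F : MvPolynomial (Fin (N + 1)) k))
    (hG : (c.F : MvPolynomial (Fin (N + 1)) k) ∣
      (c'.G : MvPolynomial (Fin (N + 1)) k) - b • (c.G : MvPolynomial (Fin (N + 1)) k)) :
    c.mk' = c'.mk' := by
  obtain ⟨K, hK⟩ := exists_form_of_dvd hd c.F.2 (c'.G - b • c.G).2 hG
  refine (Cone.mk'_eq_iff hd c c').2 ⟨Units.mk0 a ha, Units.mk0 b hb, K, hF, ?_⟩
  rw [← hK, Submodule.coe_sub, Submodule.coe_smul, Units.val_mk0]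
  ring

variable {l l' : ℤ × ℤ} {U V : Set (Hbar k N d₁ d₂)} {s s' : Cone k N d₁ d₂ → k}

theorem IsSection.mono (hs : IsSection l U s) (h : V ⊆ U) : IsSection l V s :=
  ⟨fun c hc => hs.regular c (h hc), fun c c' a b K hc => hs.equivariant c c' a b K (h hc)⟩

theorem IsSection.mul (hs : IsSection l U s) (hs' : IsSection l' U s') :
    IsSection (l + l') U (fun c => s c * s' c) where
  regular c hc := (hs.regular c hc).mul (hs'.regular c hc)
  equivariant c c' a b K hc hF hG := by
    rw [hs.equivariant c c' a b K hc hF hG, hs'.equivariant c c' a b K hc hF hG, Prod.fst_add,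
      Prod.snd_add, zpow_add, zpow_add]
    push_cast
    ring

theorem IsSection.sub_const_mul (hs : IsSection l U s) (hs' : IsSection l U s') (x : k) :
    IsSection l U (fun c => s c + -x * s' c) where
  regular c hc := (hs.regular c hc).add ((RegularAt.const _ (-x) c).mul (hs'.regular c hc))
  equivariant c c' a b K hc hF hG := by
    rw [hs.equivariant c c' a b K hc hF hG, hs'.equivariant c c' a b K hc hF hG]
    ring

theorem isSection_one : IsSection (0 : ℤ × ℤ) U (fun _ => (1 : k)) where
  regular c _ := RegularAt.const _ 1 c
  equivariant c c' a b K _ _ _ := by simp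

theorem IsSection.pow (hs : IsSection l U s) (n : ℕ) :
    IsSection (n • l) U (fun c => s c ^ n) := by
  induction n with
  | zero => simpa using isSection_one
  | succ n ih =>
    rw [succ_nsmul]
    simpa only [pow_succ] using ih.mul hs

theorem IsSection.inv (hs : IsSection l U s) (h : ∀ c : Cone k N d₁ d₂, c.mk' ∈ U → s c ≠ 0) :
    IsSection (-l) U (fun c => (s c)⁻¹) where
  regular c hc := (hs.regular c hc).inv (h c hc)
  equivariant c c' a b K hc hF hG := by
    rw [hs.equivariant c c' a b K hc hF hG, mul_inv, Prod.fst_neg, Prod.snd_neg, zpow_neg,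
      zpow_neg, ← Units.val_inv_eq_inv_val, mul_inv]

theorem IsSection.zpow (hs : IsSection l U s) (h : ∀ c : Cone k N d₁ d₂, c.mk' ∈ U → s c ≠ 0)
    (n : ℤ) : IsSection (n • l) U (fun c => s c ^ n) := by
  obtain ⟨n, rfl | rfl⟩ := n.eq_nat_or_neg
  · simpa using hs.pow n
  · simpa using (hs.pow n).inv (fun c hc => pow_ne_zero n (h c hc))

theorem IsSection.ne_zero_of_mk'_eq (hd : d₁ ≤ d₂) (hs : IsSection l U s)
    {c c' : Cone k N d₁ d₂} (hc : c.mk' ∈ U) (h : c.mk' = c'.mk') (h0 : s c ≠ 0) : s c' ≠ 0 := by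
  obtain ⟨a, b, K, hF, hG⟩ := (Cone.mk'_eq_iff hd c c').1 h
  rw [hs.equivariant c c' a b K hc hF hG]
  exact mul_ne_zero (Units.ne_zero _) h0

theorem IsSection.eq_of_mk'_eq (hd : d₁ ≤ d₂) (hs : IsSection 0 U s)
    {c c' : Cone k N d₁ d₂} (hc : c.mk' ∈ U) (h : c.mk' = c'.mk') : s c = s c' := by
  obtain ⟨a, b, K, hF, hG⟩ := (Cone.mk'_eq_iff hd c c').1 h
  rw [hs.equivariant c c' a b K hc hF hG]
  simp

/-- Sections of `𝒪(0, 0)` are regular functions on the variety of points `[F, G]`. -/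
theorem IsSection.exists_descent (hd : d₁ ≤ d₂) (hU : IsOpen U) (hs : IsSection 0 U s) :
    ∃ h : Hbar k N d₁ d₂ → k, (∀ c : Cone k N d₁ d₂, c.mk' ∈ U → h c.mk' = s c) ∧
      ∀ x ∈ U, Hbar.IsRegularAt h x := by
  have hh : ∀ c : Cone k N d₁ d₂, c.mk' ∈ U →
      s (Function.surjInv Cone.mk'_surjective c.mk') = s c := fun c hc =>
    (hs.eq_of_mk'_eq hd hc (Function.surjInv_eq Cone.mk'_surjective _).symm).symm
  refine ⟨fun x => s (Function.surjInv Cone.mk'_surjective x), hh, ?_⟩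
  rintro _ hx c rfl
  obtain ⟨p, hp, hp'⟩ := (Hbar.isOpen_iff U).1 hU c hx
  exact (hs.regular c hx).congr p hp fun c' hc' => hh c' (hp' c' hc')

/-- The set of points where a section does not vanish. -/
def nonvanishing (s : Cone k N d₁ d₂ → k) : Set (Hbar k N d₁ d₂) :=
  {x | ∃ c : Cone k N d₁ d₂, c.mk' = x ∧ s c ≠ 0}

theorem IsSection.mk'_mem_nonvanishing (hd : d₁ ≤ d₂) (hs : IsSection l Set.univ s)
    (c : Cone k N d₁ d₂) : c.mk' ∈ nonvanishing s ↔ s c ≠ 0 :=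
  ⟨fun ⟨_, h, h0⟩ => hs.ne_zero_of_mk'_eq hd (Set.mem_univ _) h h0, fun h => ⟨c, rfl, h⟩⟩

theorem IsSection.isOpen_nonvanishing (hd : d₁ ≤ d₂) (hs : IsSection l Set.univ s) :
    IsOpen (nonvanishing s) := by
  rw [Hbar.isOpen_iff]
  intro c hc
  rw [hs.mk'_mem_nonvanishing hd] at hc
  obtain ⟨p, q, hq, H⟩ := hs.regular c (Set.mem_univ _)
  refine ⟨p * q, ?_, fun c' hc' => ?_⟩
  · rw [map_mul]
    refine mul_ne_zero (fun hp => hc ?_) hq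
    rw [H c hq, hp, zero_div]
  · rw [map_mul] at hc'
    rw [hs.mk'_mem_nonvanishing hd, H c' (right_ne_zero_of_mul hc')]
    exact div_ne_zero (left_ne_zero_of_mul hc') (right_ne_zero_of_mul hc')

/-- The coefficients of `F` are sections of `𝒪(1, 0)`. -/
theorem isSection_coeff (m : Fin (N + 1) →₀ ℕ) :
    IsSection (1, 0) U (fun c : Cone k N d₁ d₂ => coeff m (c.F : MvPolynomial _ k)) where
  regular c _ := by
    by_cases hm : m.degree = d₁
    · have := RegularAt.of_eval (coords := Cone.coords)
        (X (Sum.inl ⟨m, (mem_mon_iff m).2 hm⟩) : CoeffRing k N d₁ d₂) c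
      simpa [Cone.coords, coordsOf] using this
    · have h0 : ∀ c : Cone k N d₁ d₂, coeff m (c.F : MvPolynomial _ k) = 0 := fun c =>
        ((mem_homogeneousSubmodule _ _).1 c.F.2).coeff_eq_zero hm
      simpa only [h0] using RegularAt.const _ 0 c
  equivariant c c' a b K _ hF _ := by
    rw [hF, coeff_smul]
    simp

/-- `𝒪(1, 0)` is base-point free. -/
theorem basePointFree_one_zero : BasePointFree k N d₁ d₂ (1, 0) := by
  intro x
  obtain ⟨c, rfl⟩ := Cone.mk'_surjective x
  have h : (c.F : MvPolynomial (Fin (N + 1)) k) ≠ 0 := fun h => c.F_ne (ZeroMemClass.coe_eq_zero.1 h)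
  obtain ⟨m, hm⟩ := ne_zero_iff.1 h
  exact ⟨_, isSection_coeff m, c, rfl, hm⟩

end Sections

/-! ### Changes of coordinates and the sections given by the remainder -/

section Remainder

open MvPolynomial

variable {k : Type*} [Field k] {N d₁ d₂ : ℕ}

theorem isHomogeneous_substitute (γ : GL (Fin (N + 1)) k) {d : ℕ}
    {F : MvPolynomial (Fin (N + 1)) k} (hF : F.IsHomogeneous d) :
    (substitute γ F).IsHomogeneous d := by
  have := hF.aeval (fun i => ∑ j, C (γ.1 i j) * X j) (n := 1)
    (fun i => IsHomogeneous.sum _ _ _ fun j _ => isHomogeneous_C_mul_X _ _)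
  rwa [one_mul] at this

theorem substitute_substitute (γ δ : GL (Fin (N + 1)) k) (F : MvPolynomial (Fin (N + 1)) k) :
    substitute γ (substitute δ F) = substitute (δ * γ) F := by
  have : (substitute γ).comp (substitute δ) = substitute (δ * γ) := by
    refine algHom_ext fun i => ?_
    simp only [substitute, AlgHom.comp_apply, aeval_X, map_sum, map_mul, algHom_C,
      algebraMap_eq, Finset.mul_sum, Units.val_mul, Matrix.mul_apply, Finset.sum_mul]
    rw [Finset.sum_comm]
    refine Finset.sum_congr rfl fun j _ => Finset.sum_congr rfl fun i _ => ?_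
    ring
  rw [← this, AlgHom.comp_apply]

theorem substitute_one (F : MvPolynomial (Fin (N + 1)) k) : substitute 1 F = F := by
  have : substitute (1 : GL (Fin (N + 1)) k) = AlgHom.id k _ := by
    refine algHom_ext fun i => ?_
    simp [substitute, Matrix.one_apply]
  rw [this, AlgHom.id_apply]

theorem substitute_inv_substitute (γ : GL (Fin (N + 1)) k) (F : MvPolynomial (Fin (N + 1)) k) :
    substitute γ⁻¹ (substitute γ F) = F := by
  rw [substitute_substitute, mul_inv_cancel, substitute_one]

theorem substitute_dvd_substitute_iff (γ : GL (Fin (N + 1)) k)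
    (F G : MvPolynomial (Fin (N + 1)) k) : substitute γ F ∣ substitute γ G ↔ F ∣ G := by
  refine ⟨fun h => ?_, fun h => map_dvd _ h⟩
  have := map_dvd (substitute γ⁻¹) h
  rwa [substitute_inv_substitute, substitute_inv_substitute] at this

/-- The coefficients of `F` and `G` in the coordinate system given by `γ` are (linear) polynomials
in the coefficients of `F` and `G`. -/
theorem exists_coords_substitute (γ : GL (Fin (N + 1)) k) :
    ∃ L : Mon N d₁ ⊕ Mon N d₂ → CoeffRing k N d₁ d₂, ∀ c : Cone k N d₁ d₂,
      coordsOf (substitute γ (c.F : MvPolynomial (Fin (N + 1)) k))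
        (substitute γ (c.G : MvPolynomial (Fin (N + 1)) k)) = fun i => eval c.coords (L i) := by
  let Γ : Fin (N + 1) → MvPolynomial (Fin (N + 1)) (CoeffRing k N d₁ d₂) :=
    fun i => ∑ j, C (C (γ.1 i j)) * X j
  refine ⟨Sum.elim (fun M => coeff M.1 (bind₁ Γ (genericF k N d₁ d₂)))
    (fun M => coeff M.1 (bind₁ Γ (genericG k N d₁ d₂))), fun c => ?_⟩
  have h : ∀ P : MvPolynomial (Fin (N + 1)) (CoeffRing k N d₁ d₂),
      map (eval c.coords) (bind₁ Γ P) = substitute γ (map (eval c.coords) P) := by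
    intro P
    rw [map_bind₁]
    simp [Γ, substitute, aeval_eq_bind₁]
  funext i
  rcases i with M | M
  · simp only [coordsOf, Sum.elim_inl]
    rw [← coeff_map, h, Cone.coords, map_genericF c.F.2]
  · simp only [coordsOf, Sum.elim_inr]
    rw [← coeff_map, h, Cone.coords, map_genericG c.G.2]

theorem regularAt_remainderCoeff (r : MvPolynomial (Fin (N + 1)) (CoeffRing k N d₁ d₂))
    (γ : GL (Fin (N + 1)) k) (M : Mon N d₂) (c : Cone k N d₁ d₂) :
    RegularAt Cone.coords (remainderCoeff r γ M) c := by
  obtain ⟨L, hL⟩ := exists_coords_substitute (d₁ := d₁) (d₂ := d₂) γ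
  have := RegularAt.of_eval (coords := Cone.coords) (bind₁ L (coeff M.1 r)) c
  convert this using 2 with c'
  rw [remainderCoeff, hL]
  exact (eval₂Hom_bind₁ (RingHom.id k) c'.coords L (coeff M.1 r)).symm

theorem remainderCoeff_genericRem (γ : GL (Fin (N + 1)) k) (M : Mon N d₂)
    (c : Cone k N d₁ d₂) :
    remainderCoeff (genericRem k N d₁ d₂) γ M c =
      coeff M.1 (divRem d₁ (substitute γ c.F) (d₂ - d₁ + 1) (substitute γ c.G)) :=
  eval_coeff_genericRem (isHomogeneous_substitute γ c.F.2) (isHomogeneous_substitute γ c.G.2) M.1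

/-- The coefficients of the remainder are sections of `𝒪(d₂ - d₁ + 1, 1)`: the remainder is linear
in `G`, kills the multiples of `F`, and each of the `d₂ - d₁ + 1` division steps multiplies the
degree in `F` by one. -/
theorem isSection_remainderCoeff (hd : d₁ ≤ d₂) (U : Set (Hbar k N d₁ d₂))
    (γ : GL (Fin (N + 1)) k) (M : Mon N d₂) :
    IsSection ((d₂ : ℤ) - d₁ + 1, 1) U (remainderCoeff (genericRem k N d₁ d₂) γ M) where
  regular c _ := regularAt_remainderCoeff _ γ M c
  equivariant c c' a b K _ hF hG := by
    have hD : (d₂ : ℤ) - d₁ + 1 = (d₂ - d₁ + 1 : ℕ) := by omega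
    have hK : LowX₀ (d₂ - d₁ + 1) (substitute γ (K : MvPolynomial (Fin (N + 1)) k)) :=
      LowX₀.of_isHomogeneous (isHomogeneous_substitute γ K.2)
    rw [remainderCoeff_genericRem, remainderCoeff_genericRem, hF, hG, hD, map_add, map_smul,
      map_smul, map_mul, smul_eq_C_mul, smul_eq_C_mul, divRem_C_mul_left, divRem_add,
      divRem_mul_self (isHomogeneous_substitute γ c.F.2) hK, add_zero, divRem_C_mul, coeff_C_mul,
      coeff_C_mul, zpow_natCast, zpow_one]
    push_cast
    ring

theorem eval_single_of_isHomogeneous {d : ℕ} {F : MvPolynomial (Fin (N + 1)) k}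
    (hF : F.IsHomogeneous d) :
    eval (Pi.single 0 1) F = coeff (Finsupp.single 0 d) F := by
  classical
  rw [eval_eq', Finset.sum_eq_single (Finsupp.single 0 d)]
  · rw [Finset.prod_eq_one, mul_one]
    intro i _
    by_cases hi : i = 0
    · subst hi; simp
    · simp [Finsupp.single_eq_of_ne hi]
  · intro m hm hne
    obtain ⟨i, hi, hi0⟩ : ∃ i, i ≠ 0 ∧ m i ≠ 0 := by
      by_contra! h
      refine hne ?_
      have hm0 : m = Finsupp.single 0 (m 0) := by
        ext i
        by_cases hi : i = 0
        · subst hi; simp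
        · rw [h i hi, Finsupp.single_eq_of_ne hi]
      have hdeg : m.degree = d := by
        by_contra hdeg
        exact (mem_support_iff.1 hm) (hF.coeff_eq_zero hdeg)
      rw [hm0, Finsupp.degree_single] at hdeg
      rw [hm0, hdeg]
    rw [Finset.prod_eq_zero (Finset.mem_univ i), mul_zero]
    rw [Pi.single_eq_of_ne hi, zero_pow hi0]
  · intro h
    rw [notMem_support_iff.1 h, zero_mul]

/-- The coefficient of `X₀ ^ d` in the coordinate system given by `γ` is the value at the first
column of `γ`. -/
theorem coeff_single_substitute (γ : GL (Fin (N + 1)) k) {d : ℕ}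
    {F : MvPolynomial (Fin (N + 1)) k} (hF : F.IsHomogeneous d) :
    coeff (Finsupp.single 0 d) (substitute γ F) = eval (fun i => γ.1 i 0) F := by
  rw [← eval_single_of_isHomogeneous (isHomogeneous_substitute γ hF), substitute, aeval_def,
    eval_eval₂]
  have h1 : (eval (Pi.single 0 1 : Fin (N + 1) → k)).comp
      (algebraMap k (MvPolynomial (Fin (N + 1)) k)) = RingHom.id k := by
    ext x; simp
  rw [h1]
  have h2 : (fun s => eval (Pi.single 0 1) (∑ j, C (γ.1 s j) * X j)) = fun i => γ.1 i 0 := by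
    funext i
    simp [Pi.single_apply]
  rw [h2]
  rfl

/-- Every nonzero form of degree `d` has nonzero coefficient at `X₀ ^ d` in a suitable coordinate
system. -/
theorem exists_coeff_single_substitute_ne_zero [Infinite k] {d : ℕ}
    {F : MvPolynomial (Fin (N + 1)) k} (hF : F.IsHomogeneous d) (h0 : F ≠ 0) :
    ∃ γ : GL (Fin (N + 1)) k, coeff (Finsupp.single 0 d) (substitute γ F) ≠ 0 := by
  obtain ⟨v, hv⟩ : ∃ v, eval v (F * X 0) ≠ 0 := by
    by_contra! h
    have : F * X 0 = 0 := MvPolynomial.funext fun v => by rw [h v, map_zero]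
    exact mul_ne_zero h0 (X_ne_zero 0) this
  rw [map_mul, eval_X] at hv
  have hdet : ((1 : Matrix (Fin (N + 1)) (Fin (N + 1)) k).updateCol 0 v).det ≠ 0 := by
    rw [← Matrix.cramer_apply, Matrix.cramer_one]
    exact right_ne_zero_of_mul hv
  refine ⟨Matrix.GeneralLinearGroup.mkOfDetNeZero _ hdet, ?_⟩
  rw [coeff_single_substitute _ hF]
  have : (fun i => (Matrix.GeneralLinearGroup.mkOfDetNeZero _ hdet).1 i 0) = v := by
    funext i
    simp [Matrix.GeneralLinearGroup.mkOfDetNeZero]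
  rw [this]
  exact left_ne_zero_of_mul hv

/-- In a coordinate system where `X₀ ^ d₁` has nonzero coefficient in `F`, a vanishing remainder would
mean `F ∣ G`. -/
theorem exists_remainderCoeff_ne_zero [Infinite k] (hd : d₁ ≤ d₂) (c : Cone k N d₁ d₂) :
    ∃ (γ : GL (Fin (N + 1)) k) (M : Mon N d₂),
      remainderCoeff (genericRem k N d₁ d₂) γ M c ≠ 0 := by
  have hF0 : (c.F : MvPolynomial (Fin (N + 1)) k) ≠ 0 := fun h =>
    c.F_ne (ZeroMemClass.coe_eq_zero.1 h)
  obtain ⟨γ, hγ⟩ := exists_coeff_single_substitute_ne_zero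
    ((mem_homogeneousSubmodule _ _).1 c.F.2) hF0
  refine ⟨γ, ?_⟩
  by_contra! h
  have hr : divRem d₁ (substitute γ c.F) (d₂ - d₁ + 1) (substitute γ c.G) = 0 := by
    have hr := isHomogeneous_divRem (n := d₂ - d₁ + 1) hd (isHomogeneous_substitute γ c.F.2)
      (isHomogeneous_substitute γ c.G.2)
    ext m
    rw [coeff_zero]
    by_cases hm : m.degree = d₂
    · rw [← remainderCoeff_genericRem γ ⟨m, (mem_mon_iff m).2 hm⟩ c]
      exact h _
    · exact hr.coeff_eq_zero hm
  have hid := divRem_identity d₁ (substitute γ c.F) (d₂ - d₁ + 1) (substitute γ c.G)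
  rw [hr, add_zero] at hid
  refine c.not_dvd ((substitute_dvd_substitute_iff γ _ _).1 ?_)
  have hu : IsUnit (C (coeff (Finsupp.single 0 d₁) (substitute γ (c.F : MvPolynomial _ k))) ^
      (d₂ - d₁ + 1) : MvPolynomial (Fin (N + 1)) k) :=
    ((isUnit_iff_ne_zero.2 hγ).map C).pow _
  rw [← hu.dvd_mul_left, hid]
  exact dvd_mul_left _ _

/-- `𝒪(d₂ - d₁ + 1, 1)` is base-point free. -/
theorem basePointFree_remainder [Infinite k] (hd : d₁ ≤ d₂) :
    BasePointFree k N d₁ d₂ ((d₂ : ℤ) - d₁ + 1, 1) := by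
  intro x
  obtain ⟨c, rfl⟩ := Cone.mk'_surjective x
  obtain ⟨γ, M, h⟩ := exists_remainderCoeff_ne_zero hd c
  exact ⟨_, isSection_remainderCoeff hd _ γ M, c, rfl, h⟩

theorem eq_smul_add_smul (l : ℤ × ℤ) (D : ℤ) :
    l = (l.1 - D * l.2) • ((1 : ℤ), (0 : ℤ)) + l.2 • (D, (1 : ℤ)) := by
  ext
  · simp; ring
  · simp

/-- All the line bundles `𝒪(l₁, l₂)` are trivial near every point. -/
theorem exists_local_trivialization [Infinite k] (hd : d₁ ≤ d₂) (l : ℤ × ℤ)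
    (x : Hbar k N d₁ d₂) :
    ∃ (U : Set (Hbar k N d₁ d₂)) (u : Cone k N d₁ d₂ → k), IsOpen U ∧ x ∈ U ∧ IsSection l U u ∧
      ∀ c : Cone k N d₁ d₂, c.mk' ∈ U → u c ≠ 0 := by
  obtain ⟨s, hs, c, rfl, hc⟩ := basePointFree_one_zero x
  obtain ⟨s', hs', c', hcc', hc'⟩ := basePointFree_remainder hd c.mk'
  have hU := hs.mk'_mem_nonvanishing hd
  have hU' := hs'.mk'_mem_nonvanishing hd
  have h1 : ∀ c : Cone k N d₁ d₂, c.mk' ∈ nonvanishing s ∩ nonvanishing s' → s c ≠ 0 :=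
    fun c hc => (hU c).1 hc.1
  have h2 : ∀ c : Cone k N d₁ d₂, c.mk' ∈ nonvanishing s ∩ nonvanishing s' → s' c ≠ 0 :=
    fun c hc => (hU' c).1 hc.2
  refine ⟨nonvanishing s ∩ nonvanishing s', _,
    (hs.isOpen_nonvanishing hd).inter (hs'.isOpen_nonvanishing hd), ⟨⟨c, rfl, hc⟩, c', hcc', hc'⟩,
    ?_, fun c hc => mul_ne_zero (zpow_ne_zero (l.1 - ((d₂ : ℤ) - d₁ + 1) * l.2) (h1 c hc))
      (zpow_ne_zero l.2 (h2 c hc))⟩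
  have := ((hs.mono (Set.subset_univ _)).zpow h1 (l.1 - ((d₂ : ℤ) - d₁ + 1) * l.2)).mul
    ((hs'.mono (Set.subset_univ _)).zpow h2 l.2)
  rwa [← eq_smul_add_smul] at this

theorem zeroCount_one (C : Set (Hbar k N d₁ d₂)) : zeroCount C 0 (fun _ => (1 : k)) = 0 := by
  refine (finsum_congr fun p => ?_).trans finsum_zero
  have : zeroIdeal C p.1 0 (fun _ => (1 : k)) = ⊤ := by
    rw [Ideal.eq_top_iff_one]
    refine Ideal.subset_span ⟨Set.univ, fun _ => 1, fun _ => 1, isOpen_univ, Set.mem_univ _, ?_,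
      fun _ _ => (one_mul 1).symm, rfl⟩
    rw [neg_zero]
    exact isSection_one
  rw [this]
  have : Subsingleton (localRing C p.1 ⧸ (⊤ : Ideal (localRing C p.1))) :=
    Ideal.Quotient.subsingleton_iff.2 rfl
  rw [Module.length_eq_zero, ENat.toNat_zero]

/-- A nonnegative combination of base-point free line bundles is nef: on every curve it has a
global section that does not vanish identically, and the degree is the number of its zeros. -/
theorem nef_of_eq [Infinite k] (hd : d₁ ≤ d₂) (a b : ℕ) :
    Nef k N d₁ d₂ (a • ((1 : ℤ), (0 : ℤ)) + b • ((d₂ : ℤ) - d₁ + 1, (1 : ℤ))) := by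
  intro Z hZ
  obtain ⟨x, hx⟩ := hZ.2.1.nonempty
  obtain ⟨s, hs, c, rfl, hc⟩ := basePointFree_one_zero x
  obtain ⟨s', hs', c', hcc', hc'⟩ := basePointFree_remainder hd c.mk'
  have hc'' := hs'.ne_zero_of_mk'_eq hd (Set.mem_univ _) hcc' hc'
  refine ⟨_, ⟨_, 0, _, fun _ => 1, sub_zero _, (hs.pow a).mul (hs'.pow b), isSection_one,
    ⟨c, hx, mul_ne_zero (pow_ne_zero a hc) (pow_ne_zero b hc'')⟩, ⟨c, hx, one_ne_zero⟩, rfl⟩, ?_⟩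
  rw [zeroCount_one]
  simp

end Remainder

/-! ### Regular functions on the affine line -/

section AffineLine

open Polynomial

variable {k : Type*} [Field k]

/-- A function on the affine line that is locally a quotient of polynomials is a polynomial: the
polynomials `q` such that `q h` is a polynomial function form an ideal without zeros. -/
theorem exists_polynomial_of_locally_quotient [IsAlgClosed k] (h : k → k)
    (H : ∀ t₀, ∃ P Q : k[X], Q.eval t₀ ≠ 0 ∧ ∀ t, Q.eval t ≠ 0 → h t = P.eval t / Q.eval t) :
    ∃ f : k[X], ∀ t, h t = f.eval t := by
  let J : Ideal k[X] :=
    { carrier := {q | ∃ f : k[X], ∀ t, q.eval t * h t = f.eval t}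
      add_mem' := by
        rintro _ _ ⟨f, hf⟩ ⟨g, hg⟩
        exact ⟨f + g, fun t => by rw [eval_add, eval_add, add_mul, hf, hg]⟩
      zero_mem' := ⟨0, fun t => by simp⟩
      smul_mem' := by
        rintro c _ ⟨f, hf⟩
        exact ⟨c * f, fun t => by rw [smul_eq_mul, eval_mul, eval_mul, mul_assoc, hf]⟩ }
  have hJ : ∀ t₀, ∃ q ∈ J, q.eval t₀ ≠ 0 := by
    intro t₀
    obtain ⟨P, Q, hQ, hPQ⟩ := H t₀
    refine ⟨Q * Q, ⟨Q * P, fun t => ?_⟩, by simpa using hQ⟩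
    by_cases ht : Q.eval t = 0
    · simp [ht]
    · rw [hPQ t ht, eval_mul, eval_mul]
      field_simp
  have h1 : (1 : k[X]) ∈ J := by
    obtain ⟨g, hg⟩ := (IsPrincipalIdealRing.principal J).principal
    have hg' : ∀ t, g.eval t ≠ 0 := by
      intro t ht
      obtain ⟨q, hq, hqt⟩ := hJ t
      rw [hg, Ideal.submodule_span_eq, Ideal.mem_span_singleton] at hq
      exact hqt (eval_eq_zero_of_dvd_of_eval_eq_zero hq ht)
    have hdeg : g.degree = 0 := by
      by_contra hdeg
      obtain ⟨t, ht⟩ := IsAlgClosed.exists_root g hdeg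
      exact hg' t ht
    rw [← Ideal.eq_top_iff_one, hg, Ideal.submodule_span_eq, Ideal.span_singleton_eq_top]
    exact isUnit_iff_degree_eq_zero.2 hdeg
  obtain ⟨f, hf⟩ := h1
  exact ⟨f, fun t => by rw [← hf t, eval_one, one_mul]⟩

/-- A section of a line bundle of degree `e` on the projective line, given by polynomials `f₀` and
`f₁` in the two standard charts, has `e` zeros. -/
theorem natDegree_add_rootMultiplicity_eq [Infinite k] {f₀ f₁ : k[X]} {e : ℤ} (h0 : f₀ ≠ 0)
    (h : ∀ t : kˣ, f₁.eval ((t⁻¹ : kˣ) : k) = ((t ^ (-e) : kˣ) : k) * f₀.eval (t : k)) :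
    (f₀.natDegree : ℤ) + f₁.rootMultiplicity 0 = e := by
  have hinf : {x : k | x ≠ 0}.Infinite := (Set.finite_singleton (0 : k)).infinite_compl
  have h1 : f₁ ≠ 0 := by
    rintro rfl
    refine h0 (eq_of_infinite_eval_eq _ _ (hinf.mono fun x hx => ?_))
    have := h (Units.mk0 x hx)
    rw [eval_zero, eq_comm, mul_eq_zero] at this
    rw [Set.mem_ofPred_eq, eval_zero]
    exact this.resolve_left (Units.ne_zero _)
  obtain ⟨g, hg, hg0⟩ := exists_eq_pow_rootMultiplicity_mul_and_not_dvd f₁ h1 0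
  rw [C_0, sub_zero] at hg hg0
  set m := f₁.rootMultiplicity 0
  have hgc : g.coeff 0 ≠ 0 := fun h => hg0 (X_dvd_iff.2 h)
  obtain ⟨a, b, rfl⟩ : ∃ a b : ℕ, e = a - b := by
    obtain ⟨n, rfl | rfl⟩ := e.eq_nat_or_neg
    · exact ⟨n, 0, by simp⟩
    · exact ⟨0, n, by simp⟩
  have key : X ^ (b + m + g.natDegree) * f₀ = X ^ a * g.reverse := by
    refine eq_of_infinite_eval_eq _ _ (hinf.mono fun x hx => ?_)
    have hx' : x ≠ 0 := hx
    have h2 := h (Units.mk0 x hx)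
    let _ : Invertible (x⁻¹) := invertibleOfNonzero (inv_ne_zero hx')
    have h3 := eval₂_reverse_mul_pow (RingHom.id k) (x⁻¹) g
    rw [invOf_eq_inv, inv_inv] at h3
    change eval x g.reverse * _ = eval x⁻¹ g at h3
    rw [hg, Units.val_inv_eq_inv_val, Units.val_mk0, eval_mul, eval_pow, eval_X, ← h3,
      Units.val_zpow_eq_zpow_val, Units.val_mk0, neg_sub, zpow_sub₀ hx', zpow_natCast,
      zpow_natCast] at h2
    rw [Set.mem_ofPred_eq, eval_mul, eval_mul, eval_pow, eval_pow, eval_X, pow_add, pow_add]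
    simp only [inv_pow] at h2
    field_simp at h2
    linear_combination -h2
  have hr : g.reverse ≠ 0 := by
    rw [Ne, reverse_eq_zero]
    rintro rfl
    exact hgc (coeff_zero 0)
  have hd := congrArg natDegree key
  rw [natDegree_mul (pow_ne_zero _ X_ne_zero) h0, natDegree_mul (pow_ne_zero _ X_ne_zero) hr,
    natDegree_X_pow, natDegree_X_pow, reverse_natDegree, natTrailingDegree_eq_zero.2 (Or.inr hgc)]
    at hd
  omega

end AffineLine

/-! ### Rational curves -/

section RationalCurve

variable {k : Type*} [Field k] {N d₁ d₂ : ℕ}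

variable (k N d₁ d₂) in
/-- A smooth rational curve in the variety of pairs `[F, G]`: it is the closed image of a morphism
from the projective line, given in the standard charts with coordinates `t` and `t⁻¹` by families
of pairs with polynomial coefficients. The inverse of the morphism is given by the ratio of two
sections `A`, `B` of a line bundle `𝒪(w)`. -/
structure RationalCurve where
  /-- The family of pairs on the first chart. -/
  c₀ : k → Cone k N d₁ d₂
  /-- The family of pairs on the second chart. -/
  c₁ : k → Cone k N d₁ d₂
  poly₀ : ∃ p : Mon N d₁ ⊕ Mon N d₂ → Polynomial k, ∀ t, (c₀ t).coords = fun i => (p i).eval t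
  poly₁ : ∃ p : Mon N d₁ ⊕ Mon N d₂ → Polynomial k, ∀ t, (c₁ t).coords = fun i => (p i).eval t
  /-- The exponent of the factor relating the forms `F` on the two charts. -/
  α : ℤ
  /-- The exponent of the factor relating the forms `G` on the two charts. -/
  β : ℤ
  glue : ∀ t : kˣ, ∃ K : Forms k N (d₂ - d₁),
    ((c₁ ((t⁻¹ : kˣ) : k)).F : MvPolynomial (Fin (N + 1)) k) =
      ((t ^ α : kˣ) : k) • ((c₀ t).F : MvPolynomial (Fin (N + 1)) k) ∧
    ((c₁ ((t⁻¹ : kˣ) : k)).G : MvPolynomial (Fin (N + 1)) k) =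
      ((t ^ β : kˣ) : k) • ((c₀ t).G : MvPolynomial (Fin (N + 1)) k) + K * (c₀ t).F
  /-- The line bundle of which `A` and `B` are sections. -/
  w : ℤ × ℤ
  /-- The section that is the coordinate `t` on the first chart. -/
  A : Cone k N d₁ d₂ → k
  /-- The section that is the coordinate `t⁻¹` on the second chart. -/
  B : Cone k N d₁ d₂ → k
  isSection_A : IsSection w Set.univ A
  isSection_B : IsSection w Set.univ B
  A_c₀ : ∀ t, A (c₀ t) = t
  B_c₀ : ∀ t, B (c₀ t) = 1
  A_c₁ : ∀ t, A (c₁ t) = 1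
  B_c₁ : ∀ t, B (c₁ t) = t
  isClosed' : IsClosed (Set.range (fun t => (c₀ t).mk') ∪ Set.range fun t => (c₁ t).mk')

namespace RationalCurve

open Polynomial

variable (Γ : RationalCurve k N d₁ d₂) {l : ℤ × ℤ} {U : Set (Hbar k N d₁ d₂)}
  {s : Cone k N d₁ d₂ → k}

/-- The points of the curve. -/
def carrier : Set (Hbar k N d₁ d₂) :=
  Set.range (fun t => (Γ.c₀ t).mk') ∪ Set.range fun t => (Γ.c₁ t).mk'

theorem isClosed : IsClosed Γ.carrier := Γ.isClosed'

/-- The degree of `𝒪(l₁, l₂)` on the curve. -/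
def deg (l : ℤ × ℤ) : ℤ := -(Γ.α * l.1 + Γ.β * l.2)

/-- The same curve with the two charts exchanged. -/
def swap : RationalCurve k N d₁ d₂ where
  c₀ := Γ.c₁
  c₁ := Γ.c₀
  poly₀ := Γ.poly₁
  poly₁ := Γ.poly₀
  α := Γ.α
  β := Γ.β
  glue t := by
    obtain ⟨K, hF, hG⟩ := Γ.glue t⁻¹
    rw [inv_inv] at hF hG
    have hα : ((t ^ Γ.α : kˣ) : k) * ((t⁻¹ ^ Γ.α : kˣ) : k) = 1 := by
      rw [← Units.val_mul, inv_zpow, mul_inv_cancel, Units.val_one]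
    have hβ : ((t ^ Γ.β : kˣ) : k) * ((t⁻¹ ^ Γ.β : kˣ) : k) = 1 := by
      rw [← Units.val_mul, inv_zpow, mul_inv_cancel, Units.val_one]
    refine ⟨-(((t ^ Γ.β : kˣ) : k) * ((t ^ Γ.α : kˣ) : k)) • K, ?_, ?_⟩
    · rw [hF, smul_smul, hα, one_smul]
    · rw [hF, hG, smul_add, smul_smul, hβ, one_smul, Submodule.coe_smul]
      simp only [MvPolynomial.smul_eq_C_mul, map_neg, map_mul]
      have hα' := congrArg (MvPolynomial.C (σ := Fin (N + 1))) hα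
      rw [map_mul, map_one] at hα'
      linear_combination (MvPolynomial.C ((t ^ Γ.β : kˣ) : k) * K *
        ((Γ.c₀ ((t⁻¹ : kˣ) : k)).F : MvPolynomial (Fin (N + 1)) k)) * hα'
  w := Γ.w
  A := Γ.B
  B := Γ.A
  isSection_A := Γ.isSection_B
  isSection_B := Γ.isSection_A
  A_c₀ := Γ.B_c₁
  B_c₀ := Γ.A_c₁
  A_c₁ := Γ.B_c₀
  B_c₁ := Γ.A_c₀
  isClosed' := by
    rw [Set.union_comm]
    exact Γ.isClosed'

theorem swap_carrier : Γ.swap.carrier = Γ.carrier := Set.union_comm _ _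

theorem section_glue (hs : IsSection l Set.univ s) (t : kˣ) :
    s (Γ.c₁ ((t⁻¹ : kˣ) : k)) = ((t ^ (-Γ.deg l) : kˣ) : k) * s (Γ.c₀ t) := by
  obtain ⟨K, hF, hG⟩ := Γ.glue t
  rw [hs.equivariant _ _ _ _ K (Set.mem_univ _) hF hG, deg, neg_neg, zpow_add, zpow_mul, zpow_mul]

theorem mk'_c₁_inv (hd : d₁ ≤ d₂) (t : kˣ) :
    (Γ.c₁ ((t⁻¹ : kˣ) : k)).mk' = (Γ.c₀ t).mk' := by
  obtain ⟨K, hF, hG⟩ := Γ.glue t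
  exact ((Cone.mk'_eq_iff hd _ _).2 ⟨_, _, K, hF, hG⟩).symm

theorem mk'_c₁ (hd : d₁ ≤ d₂) {t : k} (ht : t ≠ 0) : (Γ.c₁ t).mk' = (Γ.c₀ t⁻¹).mk' := by
  have := Γ.mk'_c₁_inv hd (Units.mk0 t ht)⁻¹
  rwa [inv_inv, Units.val_inv_eq_inv_val, Units.val_mk0] at this

theorem mem_carrier_iff (hd : d₁ ≤ d₂) (x : Hbar k N d₁ d₂) :
    x ∈ Γ.carrier ↔ (∃ t, (Γ.c₀ t).mk' = x) ∨ (Γ.c₁ 0).mk' = x := by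
  constructor
  · rintro (⟨t, rfl⟩ | ⟨t, rfl⟩)
    · exact Or.inl ⟨t, rfl⟩
    · by_cases ht : t = 0
      · exact Or.inr (by rw [ht])
      · exact Or.inl ⟨t⁻¹, (Γ.mk'_c₁ hd ht).symm⟩
  · rintro (⟨t, rfl⟩ | rfl)
    · exact Or.inl ⟨t, rfl⟩
    · exact Or.inr ⟨0, rfl⟩

theorem mk'_c₀_injective (hd : d₁ ≤ d₂) : Function.Injective fun t => (Γ.c₀ t).mk' := by
  intro t t' h
  obtain ⟨a, b, K, hF, hG⟩ := (Cone.mk'_eq_iff hd _ _).1 h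
  have hA := Γ.isSection_A.equivariant _ _ a b K (Set.mem_univ _) hF hG
  have hB := Γ.isSection_B.equivariant _ _ a b K (Set.mem_univ _) hF hG
  rw [Γ.B_c₀, Γ.B_c₀, mul_one] at hB
  rw [Γ.A_c₀, Γ.A_c₀, ← hB, one_mul] at hA
  exact hA.symm

theorem mk'_c₀_ne (hd : d₁ ≤ d₂) (t : k) : (Γ.c₀ t).mk' ≠ (Γ.c₁ 0).mk' := by
  intro h
  refine Γ.isSection_B.ne_zero_of_mk'_eq hd (Set.mem_univ _) h ?_ (Γ.B_c₁ 0)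
  rw [Γ.B_c₀]
  exact one_ne_zero

theorem exists_eval_c₀ (P : CoeffRing k N d₁ d₂) :
    ∃ f : k[X], ∀ t, MvPolynomial.eval (Γ.c₀ t).coords P = f.eval t := by
  obtain ⟨p, hp⟩ := Γ.poly₀
  refine ⟨MvPolynomial.aeval p P, fun t => ?_⟩
  rw [hp, ← coe_evalRingHom, MvPolynomial.aeval_def, MvPolynomial.hom_eval₂]
  have : (evalRingHom t).comp (algebraMap k k[X]) = RingHom.id k := by
    ext x; simp
  rw [this]
  rfl

/-- Regular functions pull back to regular functions on the chart. -/
theorem exists_quotient_of_regularAt {t₀ : k} (hs : RegularAt Cone.coords s (Γ.c₀ t₀)) :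
    ∃ P Q : k[X], Q.eval t₀ ≠ 0 ∧
      ∀ t, Q.eval t ≠ 0 → s (Γ.c₀ t) = P.eval t / Q.eval t := by
  obtain ⟨p, q, hq, H⟩ := hs
  obtain ⟨P, hP⟩ := Γ.exists_eval_c₀ p
  obtain ⟨Q, hQ⟩ := Γ.exists_eval_c₀ q
  refine ⟨P, Q, by rwa [← hQ], fun t ht => ?_⟩
  rw [← hQ] at ht
  rw [H _ ht, hP, hQ]

theorem exists_polynomial_of_isSection [IsAlgClosed k] (hs : IsSection l Set.univ s) :
    ∃ f : k[X], ∀ t, s (Γ.c₀ t) = f.eval t :=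
  exists_polynomial_of_locally_quotient _ fun t₀ =>
    Γ.exists_quotient_of_regularAt (hs.regular (Γ.c₀ t₀) (Set.mem_univ _))

/-! ### The topology of a rational curve -/

theorem isClosed_singleton_c₀ (hd : d₁ ≤ d₂) (t : k) :
    IsClosed ({(Γ.c₀ t).mk'} : Set (Hbar k N d₁ d₂)) := by
  have hs := Γ.isSection_A.sub_const_mul Γ.isSection_B t
  have h : ({(Γ.c₀ t).mk'} : Set (Hbar k N d₁ d₂)) =
      Γ.carrier ∩ (nonvanishing fun c => Γ.A c + -t * Γ.B c)ᶜ := by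
    ext x
    rw [Set.mem_singleton_iff, Set.mem_inter_iff, Set.mem_compl_iff]
    constructor
    · rintro rfl
      refine ⟨Or.inl ⟨t, rfl⟩, ?_⟩
      rw [hs.mk'_mem_nonvanishing hd, Γ.A_c₀, Γ.B_c₀]
      simp
    · rintro ⟨hx, hx'⟩
      obtain ⟨t', rfl⟩ | rfl := (Γ.mem_carrier_iff hd x).1 hx
      · rw [hs.mk'_mem_nonvanishing hd, Γ.A_c₀, Γ.B_c₀, not_not] at hx'
        congr 2
        linear_combination hx'
      · rw [hs.mk'_mem_nonvanishing hd, Γ.A_c₁, Γ.B_c₁] at hx'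
        simp at hx'
  rw [h]
  exact Γ.isClosed.inter (hs.isOpen_nonvanishing hd).isClosed_compl

theorem isClosed_singleton (hd : d₁ ≤ d₂) {x : Hbar k N d₁ d₂} (hx : x ∈ Γ.carrier) :
    IsClosed ({x} : Set (Hbar k N d₁ d₂)) := by
  obtain ⟨t, rfl⟩ | rfl := (Γ.mem_carrier_iff hd x).1 hx
  · exact Γ.isClosed_singleton_c₀ hd t
  · exact Γ.swap.isClosed_singleton_c₀ hd 0

theorem isClosed_of_finite (hd : d₁ ≤ d₂) {S : Set (Hbar k N d₁ d₂)} (hS : S.Finite)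
    (h : S ⊆ Γ.carrier) : IsClosed S := by
  rw [← Set.biUnion_of_singleton S]
  exact hS.isClosed_biUnion fun x hx => Γ.isClosed_singleton hd (h hx)

theorem finite_c₀_notMem {U : Set (Hbar k N d₁ d₂)} (hU : IsOpen U) {t₀ : k}
    (h : (Γ.c₀ t₀).mk' ∈ U) : {t | (Γ.c₀ t).mk' ∉ U}.Finite := by
  obtain ⟨p, hp, hp'⟩ := (Hbar.isOpen_iff U).1 hU _ h
  obtain ⟨f, hf⟩ := Γ.exists_eval_c₀ p
  have hf0 : f ≠ 0 := by
    rintro rfl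
    rw [hf, eval_zero] at hp
    exact hp rfl
  classical
  refine (f.roots.toFinset.finite_toSet).subset fun t ht => ?_
  rw [Finset.mem_coe, Multiset.mem_toFinset, mem_roots hf0, IsRoot, ← hf]
  by_contra h0
  exact ht (hp' _ h0)

/-- A nonempty open subset of the curve contains all but finitely many points. -/
theorem finite_c₀_notMem_of_nonempty (hd : d₁ ≤ d₂) {U : Set (Hbar k N d₁ d₂)} (hU : IsOpen U)
    (h : (Γ.carrier ∩ U).Nonempty) : {t | (Γ.c₀ t).mk' ∉ U}.Finite := by
  obtain ⟨x, hx, hxU⟩ := h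
  obtain ⟨t, rfl⟩ | rfl := (Γ.mem_carrier_iff hd x).1 hx
  · exact Γ.finite_c₀_notMem hU hxU
  · have h1 := Γ.swap.finite_c₀_notMem hU hxU
    refine ((h1.image fun t => t⁻¹).union (Set.finite_singleton 0)).subset fun t ht => ?_
    by_cases h0 : t = 0
    · exact Or.inr h0
    · refine Or.inl ⟨t⁻¹, ?_, inv_inv t⟩
      change (Γ.c₁ t⁻¹).mk' ∉ U
      rw [Γ.mk'_c₁ hd (inv_ne_zero h0), inv_inv]
      exact ht

/-- The neighbourhoods of a point of the curve, in terms of the coordinate `t`. -/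
theorem nhdsWithin_c₀ (hd : d₁ ≤ d₂) (t₀ : k) :
    𝓝[Γ.carrier] (Γ.c₀ t₀).mk' =
      Filter.map (fun t => (Γ.c₀ t).mk') (pure t₀ ⊔ Filter.cofinite) := by
  ext S
  rw [mem_nhdsWithin, Filter.mem_map, Filter.mem_sup, Filter.mem_pure, Filter.mem_cofinite]
  constructor
  · rintro ⟨U, hU, hxU, hUS⟩
    refine ⟨hUS ⟨hxU, Or.inl ⟨t₀, rfl⟩⟩, (Γ.finite_c₀_notMem hU hxU).subset fun t ht hU => ?_⟩
    exact ht (hUS ⟨hU, Or.inl ⟨t, rfl⟩⟩)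
  · rintro ⟨h0, hfin⟩
    let T : Set (Hbar k N d₁ d₂) :=
      (fun t => (Γ.c₀ t).mk') '' ((fun t => (Γ.c₀ t).mk') ⁻¹' S)ᶜ ∪ {(Γ.c₁ 0).mk'}
    have hT : IsClosed T := by
      refine Γ.isClosed_of_finite hd ((hfin.image _).union (Set.finite_singleton _)) ?_
      rintro _ (⟨t, _, rfl⟩ | rfl)
      · exact Or.inl ⟨t, rfl⟩
      · exact Or.inr ⟨0, rfl⟩
    refine ⟨Tᶜ, hT.isOpen_compl, ?_, ?_⟩
    · rintro (⟨t, ht, h⟩ | h)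
      · exact ht (by rw [Γ.mk'_c₀_injective hd h]; exact h0)
      · exact Γ.mk'_c₀_ne hd t₀ h
    · rintro x ⟨hxT, hx⟩
      obtain ⟨t, rfl⟩ | rfl := (Γ.mem_carrier_iff hd x).1 hx
      · by_contra h
        exact hxT (Or.inl ⟨t, h, rfl⟩)
      · exact absurd (Or.inr rfl) hxT

theorem isIrreducible [Infinite k] (hd : d₁ ≤ d₂) : IsIrreducible Γ.carrier := by
  refine ⟨⟨_, Or.inl ⟨0, rfl⟩⟩, fun U V hU hV hCU hCV => ?_⟩
  have h := (Γ.finite_c₀_notMem_of_nonempty hd hU hCU).union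
    (Γ.finite_c₀_notMem_of_nonempty hd hV hCV)
  obtain ⟨t, ht⟩ := h.infinite_compl.nonempty
  rw [Set.mem_compl_iff, Set.mem_union, not_or] at ht
  exact ⟨_, Or.inl ⟨t, rfl⟩, not_not.1 ht.1, not_not.1 ht.2⟩

/-- A closed subset of the curve is finite or the whole curve. -/
theorem finite_or_carrier_subset (hd : d₁ ≤ d₂) {Z : Set (Hbar k N d₁ d₂)} (hZ : IsClosed Z)
    (h : Z ⊆ Γ.carrier) : Z.Finite ∨ Γ.carrier ⊆ Z := by
  by_cases hC : Γ.carrier ⊆ Z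
  · exact Or.inr hC
  · left
    obtain ⟨x, hx, hxZ⟩ := Set.not_subset.1 hC
    have hfin := Γ.finite_c₀_notMem_of_nonempty hd hZ.isOpen_compl ⟨x, hx, hxZ⟩
    refine ((hfin.image fun t => (Γ.c₀ t).mk').union (Set.finite_singleton (Γ.c₁ 0).mk')).subset ?_
    intro y hy
    obtain ⟨t, rfl⟩ | rfl := (Γ.mem_carrier_iff hd y).1 (h hy)
    · exact Or.inl ⟨t, fun h => h hy, rfl⟩
    · exact Or.inr rfl

theorem topologicalKrullDim_carrier [Infinite k] (hd : d₁ ≤ d₂) :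
    topologicalKrullDim Γ.carrier = 1 := by
  have hinc : Topology.IsClosedEmbedding (Subtype.val : Γ.carrier → Hbar k N d₁ d₂) :=
    Γ.isClosed.isClosedEmbedding_subtypeVal
  have hcl : ∀ x : Γ.carrier, IsClosed ({x} : Set Γ.carrier) := by
    intro x
    rw [hinc.isClosed_iff_image_isClosed, Set.image_singleton]
    exact Γ.isClosed_singleton hd x.2
  have hdich : ∀ Z : Set Γ.carrier, IsClosed Z → Z.Finite ∨ Z = Set.univ := by
    intro Z hZ
    rcases Γ.finite_or_carrier_subset hd (hinc.isClosedMap Z hZ)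
      (by rintro _ ⟨x, _, rfl⟩; exact x.2) with h | h
    · exact Or.inl (h.of_finite_image Subtype.val_injective.injOn)
    · refine Or.inr (Set.eq_univ_of_forall fun x => ?_)
      obtain ⟨y, hy, hxy⟩ := h x.2
      rwa [← Subtype.val_injective hxy]
  have hsub : ∀ Z : Set Γ.carrier, IsIrreducible Z → Z.Finite → ∃ x, Z = {x} := by
    intro Z hZ hfin
    obtain ⟨x, hx⟩ := hZ.nonempty
    refine ⟨x, Set.Subset.antisymm ?_ (Set.singleton_subset_iff.2 hx)⟩
    have hfin' : IsClosed (Z \ {x}) := by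
      rw [← Set.biUnion_of_singleton (Z \ {x})]
      exact (hfin.subset Set.sdiff_subset).isClosed_biUnion fun y _ => hcl y
    rcases (isPreirreducible_iff_isClosed_union_isClosed.1 hZ.isPreirreducible) {x} (Z \ {x})
      (hcl x) hfin' (by rw [Set.union_sdiff_self]; exact Set.subset_union_right) with h | h
    · exact h
    · exact absurd rfl (h hx).2
  rw [topologicalKrullDim]
  refine le_antisymm ?_ ?_
  · rw [Order.krullDim_le_one_iff]
    intro Z
    rcases hdich Z.carrier Z.isClosed' with h | h
    · left
      obtain ⟨x, hx⟩ := hsub _ Z.isIrreducible' h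
      intro W hW
      have hW' : W.carrier ⊆ {x} := hx ▸ hW
      obtain ⟨y, hy⟩ := W.isIrreducible'.nonempty
      have hyx : y = x := hW' hy
      change Z.carrier ⊆ W.carrier
      rw [hx, Set.singleton_subset_iff, ← hyx]
      exact hy
    · right
      intro W _
      change W.carrier ⊆ Z.carrier
      rw [h]
      exact Set.subset_univ _
  · rw [Order.one_le_krullDim_iff]
    have huniv : IsIrreducible (Set.univ : Set Γ.carrier) := by
      have := isIrreducible_iff_irreducibleSpace.1 (Γ.isIrreducible hd)
      exact IrreducibleSpace.isIrreducible_univ _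
    let x : Γ.carrier := ⟨(Γ.c₀ 0).mk', Or.inl ⟨0, rfl⟩⟩
    let y : Γ.carrier := ⟨(Γ.c₁ 0).mk', Or.inr ⟨0, rfl⟩⟩
    refine ⟨⟨{x}, isIrreducible_singleton, hcl x⟩, ⟨Set.univ, huniv, isClosed_univ⟩, ?_⟩
    refine lt_of_le_not_ge (fun _ _ => Set.mem_univ _) fun h => ?_
    have hy : y ∈ ({x} : Set Γ.carrier) := h (Set.mem_univ y)
    exact Γ.mk'_c₀_ne hd 0 (congrArg Subtype.val hy).symm

theorem isCurve [Infinite k] (hd : d₁ ≤ d₂) : IsCurve Γ.carrier :=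
  ⟨Γ.isClosed, Γ.isIrreducible hd, Γ.topologicalKrullDim_carrier hd⟩

end RationalCurve

end RationalCurve

/-! ### The local rings of a rational curve -/

section LocalRing

open Polynomial

variable {k : Type*} [Field k] {N d₁ d₂ : ℕ}

theorem RegularAt.polynomial_eval {ι T : Type*} {coords : T → ι → k} {s : T → k} {t : T}
    (hs : RegularAt coords s t) (P : k[X]) : RegularAt coords (fun x => P.eval (s x)) t := by
  induction P using Polynomial.induction_on' with
  | add P Q hP hQ => simpa only [eval_add] using hP.add hQ
  | monomial n a =>
    simp only [eval_monomial]
    refine (RegularAt.const _ a t).mul ?_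
    induction n with
    | zero => simpa only [pow_zero] using RegularAt.const _ 1 t
    | succ n ih => simpa only [pow_succ] using ih.mul hs

theorem ord_pow_mul_unit {R : Type*} [CommRing R] {ϖ u : R} (hϖ : ϖ ∈ nonZeroDivisors R)
    (h1 : Ring.ord R ϖ = 1) (hu : IsUnit u) (n : ℕ) : Ring.ord R (ϖ ^ n * u) = n := by
  rw [Ring.ord_mul_of_isUnit_right hu, Ring.ord_pow hϖ, h1, nsmul_eq_mul, mul_one]

namespace RationalCurve

variable (Γ : RationalCurve k N d₁ d₂) {l : ℤ × ℤ} {s : Cone k N d₁ d₂ → k} {t₀ : k}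

/-- An element of the local ring of the curve at the point with coordinate `t₀` is represented by
the function `φ` of the coordinate `t` if it is the germ of a function that agrees with `φ` at `t₀`
and at all but finitely many other points. -/
def IsRep (g : localRing Γ.carrier (Γ.c₀ t₀).mk') (φ : k → k) : Prop :=
  ∃ h : Hbar k N d₁ d₂ → k, (g : Filter.Germ (𝓝[Γ.carrier] (Γ.c₀ t₀).mk') k) = ↑h ∧
    (fun t => h (Γ.c₀ t).mk') =ᶠ[pure t₀ ⊔ Filter.cofinite] φ

variable {Γ}

theorem germ_eq_iff (hd : d₁ ≤ d₂) (h h' : Hbar k N d₁ d₂ → k) :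
    (h : Filter.Germ (𝓝[Γ.carrier] (Γ.c₀ t₀).mk') k) = ↑h' ↔
      (fun t => h (Γ.c₀ t).mk') =ᶠ[pure t₀ ⊔ Filter.cofinite] fun t => h' (Γ.c₀ t).mk' := by
  rw [Filter.Germ.coe_eq, Γ.nhdsWithin_c₀ hd, Filter.EventuallyEq, Filter.eventually_map]
  rfl

theorem IsRep.eq (hd : d₁ ≤ d₂) {g g' : localRing Γ.carrier (Γ.c₀ t₀).mk'} {φ φ' : k → k}
    (hg : Γ.IsRep g φ) (hg' : Γ.IsRep g' φ') (h : φ =ᶠ[pure t₀ ⊔ Filter.cofinite] φ') :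
    g = g' := by
  obtain ⟨u, hu, hu'⟩ := hg
  obtain ⟨v, hv, hv'⟩ := hg'
  refine Subtype.ext ?_
  rw [hu, hv, germ_eq_iff hd]
  exact hu'.trans (h.trans hv'.symm)

theorem IsRep.congr {g : localRing Γ.carrier (Γ.c₀ t₀).mk'} {φ φ' : k → k}
    (hg : Γ.IsRep g φ) (h : φ =ᶠ[pure t₀ ⊔ Filter.cofinite] φ') : Γ.IsRep g φ' := by
  obtain ⟨u, hu, hu'⟩ := hg
  exact ⟨u, hu, hu'.trans h⟩

theorem IsRep.eventuallyEq (hd : d₁ ≤ d₂) {g : localRing Γ.carrier (Γ.c₀ t₀).mk'} {φ φ' : k → k}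
    (hg : Γ.IsRep g φ) (hg' : Γ.IsRep g φ') : φ =ᶠ[pure t₀ ⊔ Filter.cofinite] φ' := by
  obtain ⟨u, hu, hu'⟩ := hg
  obtain ⟨v, hv, hv'⟩ := hg'
  rw [hu, germ_eq_iff hd] at hv
  exact hu'.symm.trans (hv.trans hv')

theorem IsRep.mul {g g' : localRing Γ.carrier (Γ.c₀ t₀).mk'} {φ φ' : k → k}
    (hg : Γ.IsRep g φ) (hg' : Γ.IsRep g' φ') : Γ.IsRep (g * g') (fun t => φ t * φ' t) := by
  obtain ⟨u, hu, hu'⟩ := hg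
  obtain ⟨v, hv, hv'⟩ := hg'
  exact ⟨u * v, by rw [Subring.coe_mul, hu, hv]; rfl, hu'.mul hv'⟩

theorem isRep_one : Γ.IsRep (1 : localRing Γ.carrier (Γ.c₀ t₀).mk') (fun _ => 1) :=
  ⟨fun _ => 1, rfl, Filter.EventuallyEq.rfl⟩

theorem isRep_zero : Γ.IsRep (0 : localRing Γ.carrier (Γ.c₀ t₀).mk') (fun _ => 0) :=
  ⟨fun _ => 0, rfl, Filter.EventuallyEq.rfl⟩

theorem IsRep.pow {g : localRing Γ.carrier (Γ.c₀ t₀).mk'} {φ : k → k}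
    (hg : Γ.IsRep g φ) (n : ℕ) : Γ.IsRep (g ^ n) (fun t => φ t ^ n) := by
  induction n with
  | zero => simpa only [pow_zero] using isRep_one
  | succ n ih => simpa only [pow_succ] using ih.mul hg

theorem eventually_eval_ne_zero {Q : k[X]} (hQ : Q.eval t₀ ≠ 0) :
    ∀ᶠ t in pure t₀ ⊔ Filter.cofinite, Q.eval t ≠ 0 := by
  classical
  rw [Filter.eventually_sup, Filter.eventually_pure, Filter.eventually_cofinite]
  refine ⟨hQ, (Q.roots.toFinset.finite_toSet).subset fun t ht => ?_⟩
  have hQ0 : Q ≠ 0 := by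
    rintro rfl
    exact hQ eval_zero
  rw [Finset.mem_coe, Multiset.mem_toFinset, mem_roots hQ0]
  exact not_not.1 ht

/-- Every element of the local ring is represented by a quotient of polynomials. -/
theorem exists_isRep_div (g : localRing Γ.carrier (Γ.c₀ t₀).mk') :
    ∃ P Q : k[X], Q.eval t₀ ≠ 0 ∧ Γ.IsRep g fun t => P.eval t / Q.eval t := by
  obtain ⟨_, h, hh, rfl⟩ := g
  obtain ⟨P, Q, hQ, hPQ⟩ := Γ.exists_quotient_of_regularAt (hh _ rfl)
  exact ⟨P, Q, hQ, h, rfl, (eventually_eval_ne_zero hQ).mono hPQ⟩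

variable (Γ) in
/-- Every quotient of polynomials with denominator not vanishing at `t₀` represents an element of
the local ring, since the coordinate `t = A / B` is a regular function. -/
theorem exists_of_div (hd : d₁ ≤ d₂) (P : k[X]) {Q : k[X]} (hQ : Q.eval t₀ ≠ 0) :
    ∃ g : localRing Γ.carrier (Γ.c₀ t₀).mk', Γ.IsRep g fun t => P.eval t / Q.eval t := by
  have hU := Γ.isSection_B.mk'_mem_nonvanishing hd
  have hB := (Γ.isSection_B.mono (Set.subset_univ (nonvanishing Γ.B))).inv fun c hc => (hU c).1 hc
  have hAB := (Γ.isSection_A.mono (Set.subset_univ (nonvanishing Γ.B))).mul hB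
  rw [add_neg_cancel] at hAB
  obtain ⟨h, h1, h2⟩ := hAB.exists_descent hd (Γ.isSection_B.isOpen_nonvanishing hd)
  have hmem : ∀ t, (Γ.c₀ t).mk' ∈ nonvanishing Γ.B := fun t => by
    rw [hU, Γ.B_c₀]
    exact one_ne_zero
  have ht : ∀ t, h (Γ.c₀ t).mk' = t := fun t => by
    rw [h1 _ (hmem t), Γ.A_c₀, Γ.B_c₀, inv_one, mul_one]
  refine ⟨⟨((fun x => P.eval (h x) * (Q.eval (h x))⁻¹ : Hbar k N d₁ d₂ → k) :
    Filter.Germ (𝓝[Γ.carrier] (Γ.c₀ t₀).mk') k), _, fun c hc => ?_, rfl⟩, _, rfl, ?_⟩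
  · have hreg := h2 _ (hmem t₀) c hc
    refine (hreg.polynomial_eval P).mul ((hreg.polynomial_eval Q).inv ?_)
    rwa [hc, ht]
  · refine Filter.Eventually.of_forall fun t => ?_
    change P.eval (h _) * (Q.eval (h _))⁻¹ = _
    rw [ht]
    exact (div_eq_mul_inv _ _).symm

theorem isUnit_of_isRep (hd : d₁ ≤ d₂) {g : localRing Γ.carrier (Γ.c₀ t₀).mk'} {P Q : k[X]}
    (hP : P.eval t₀ ≠ 0) (hQ : Q.eval t₀ ≠ 0) (hg : Γ.IsRep g fun t => P.eval t / Q.eval t) :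
    IsUnit g := by
  obtain ⟨g', hg'⟩ := Γ.exists_of_div hd Q hP
  refine IsUnit.of_mul_eq_one g' ((hg.mul hg').eq hd isRep_one ?_)
  filter_upwards [eventually_eval_ne_zero hP, eventually_eval_ne_zero hQ] with t h1 h2
  field_simp

variable {ϖ : localRing Γ.carrier (Γ.c₀ t₀).mk'}

/-- The germ of `t - t₀` is not a zero divisor. -/
theorem mem_nonZeroDivisors_of_isRep [Infinite k] (hd : d₁ ≤ d₂)
    (hϖ : Γ.IsRep ϖ fun t => t - t₀) :
    ϖ ∈ nonZeroDivisors (localRing Γ.carrier (Γ.c₀ t₀).mk') := by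
  rw [mem_nonZeroDivisors_iff_right]
  intro g hg
  obtain ⟨P, Q, hQ, hPQ⟩ := exists_isRep_div g
  have h0 := hPQ.mul hϖ
  rw [hg] at h0
  have h1 := (h0.eventuallyEq hd isRep_zero).and (eventually_eval_ne_zero hQ)
  rw [Filter.eventually_sup, Filter.eventually_cofinite] at h1
  have hP : P = 0 := by
    refine eq_of_infinite_eval_eq _ _
      ((h1.2.union (Set.finite_singleton t₀)).infinite_compl.mono fun t ht => ?_)
    rw [Set.mem_compl_iff, Set.mem_union, not_or] at ht
    obtain ⟨h2, h3⟩ := not_not.1 ht.1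
    have h4 : t - t₀ ≠ 0 := sub_ne_zero.2 ht.2
    rw [Set.mem_ofPred_eq, eval_zero]
    exact (div_eq_zero_iff.1 ((mul_eq_zero.1 h2).resolve_right h4)).resolve_right h3
  refine hPQ.eq hd isRep_zero (Filter.Eventually.of_forall fun t => ?_)
  change P.eval t / Q.eval t = 0
  rw [hP, eval_zero, zero_div]

theorem ord_eq_one (hd : d₁ ≤ d₂) (hϖ : Γ.IsRep ϖ fun t => t - t₀) :
    Ring.ord (localRing Γ.carrier (Γ.c₀ t₀).mk') ϖ = 1 := by
  have hmax : (Ideal.span {ϖ}).IsMaximal := by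
    rw [Ideal.isMaximal_iff]
    constructor
    · intro h
      obtain ⟨g, hg⟩ := Ideal.mem_span_singleton.1 h
      obtain ⟨P, Q, hQ, hPQ⟩ := exists_isRep_div g
      have h1 := hϖ.mul hPQ
      rw [← hg] at h1
      have h2 := isRep_one.eventuallyEq hd h1
      rw [Filter.EventuallyEq, Filter.eventually_sup, Filter.eventually_pure] at h2
      simpa using h2.1
    · intro J g hJ hg hgJ
      obtain ⟨P, Q, hQ, hPQ⟩ := exists_isRep_div g
      have hP : P.eval t₀ ≠ 0 := by
        intro h0
        obtain ⟨P', rfl⟩ := dvd_iff_isRoot.2 h0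
        obtain ⟨g', hg'⟩ := Γ.exists_of_div hd P' hQ
        refine hg (Ideal.mem_span_singleton.2 ⟨g', hPQ.eq hd (hϖ.mul hg') ?_⟩)
        refine Filter.Eventually.of_forall fun t => ?_
        simp only [eval_mul, eval_sub, eval_X, eval_C, mul_div_assoc]
      rw [← Ideal.eq_top_iff_one]
      exact Ideal.eq_top_of_isUnit_mem _ hgJ (isUnit_of_isRep hd hP hQ hPQ)
  rw [Ring.ord, Module.length_eq_one_iff,
    isSimpleModule_iff_isSimpleModule_of_algebraMap_surjective
      (S := localRing Γ.carrier (Γ.c₀ t₀).mk' ⧸ Ideal.span {ϖ}) Ideal.Quotient.mk_surjective]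
  let _ := Ideal.Quotient.field (Ideal.span {ϖ})
  exact instIsSimpleModule _

/-- The order of vanishing of a polynomial in the coordinate `t` is the multiplicity of its root. -/
theorem ord_eq_rootMultiplicity [Infinite k] (hd : d₁ ≤ d₂) {f : k[X]} (hf : f ≠ 0)
    {g : localRing Γ.carrier (Γ.c₀ t₀).mk'} (hg : Γ.IsRep g fun t => f.eval t) :
    Ring.ord (localRing Γ.carrier (Γ.c₀ t₀).mk') g = f.rootMultiplicity t₀ := by
  obtain ⟨f', hf', hf0⟩ := exists_eq_pow_rootMultiplicity_mul_and_not_dvd f hf t₀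
  have h1 : (1 : k[X]).eval t₀ ≠ 0 := by simp
  have hf't : f'.eval t₀ ≠ 0 := fun h => hf0 (dvd_iff_isRoot.2 h)
  obtain ⟨ϖ, hϖ⟩ := Γ.exists_of_div hd (X - C t₀) h1
  obtain ⟨u, hu⟩ := Γ.exists_of_div hd f' h1
  have hϖ' : Γ.IsRep ϖ fun t => t - t₀ :=
    hϖ.congr (Filter.Eventually.of_forall fun t => by simp)
  have hgu : g = ϖ ^ f.rootMultiplicity t₀ * u := by
    refine hg.eq hd ((hϖ'.pow _).mul hu) (Filter.Eventually.of_forall fun t => ?_)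
    change f.eval t = _
    conv_lhs => rw [hf']
    simp
  have hnz := mem_nonZeroDivisors_of_isRep hd hϖ'
  have hone := ord_eq_one hd hϖ'
  have hunit := isUnit_of_isRep hd hf't h1 hu
  have hord := ord_pow_mul_unit hnz hone hunit (f.rootMultiplicity t₀)
  rw [hgu, hord]

/-- The ideal of the zero scheme of a section is generated by its local equation in the
coordinate `t`. -/
theorem zeroIdeal_eq_span [Infinite k] (hd : d₁ ≤ d₂) {f : k[X]} (hf : ∀ t, s (Γ.c₀ t) = f.eval t)
    (hs : IsSection l Set.univ s) {g : localRing Γ.carrier (Γ.c₀ t₀).mk'}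
    (hg : Γ.IsRep g fun t => f.eval t) :
    zeroIdeal Γ.carrier (Γ.c₀ t₀).mk' l s = Ideal.span {g} := by
  have key : ∀ (U : Set (Hbar k N d₁ d₂)) (u : Cone k N d₁ d₂ → k) (h : Hbar k N d₁ d₂ → k)
      (v : localRing Γ.carrier (Γ.c₀ t₀).mk'), IsOpen U → (Γ.c₀ t₀).mk' ∈ U →
      IsSection (-l) U u → (∀ c : Cone k N d₁ d₂, c.mk' ∈ U → h c.mk' = u c * s c) →
      (v : Filter.Germ (𝓝[Γ.carrier] (Γ.c₀ t₀).mk') k) = ↑h →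
      ∃ w, v = g * w ∧ (u (Γ.c₀ t₀) ≠ 0 → IsUnit w) := by
    intro U u h v hU ht₀ hu hh hv
    obtain ⟨P, Q, hQ, hPQ⟩ := Γ.exists_quotient_of_regularAt (hu.regular _ ht₀)
    obtain ⟨w, hw⟩ := Γ.exists_of_div hd P hQ
    refine ⟨w, IsRep.eq hd ⟨h, hv, Filter.EventuallyEq.rfl⟩ (hg.mul hw) ?_, fun h0 => ?_⟩
    · have hU' : ∀ᶠ t in pure t₀ ⊔ Filter.cofinite, (Γ.c₀ t).mk' ∈ U := by
        rw [Filter.eventually_sup, Filter.eventually_pure, Filter.eventually_cofinite]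
        exact ⟨ht₀, Γ.finite_c₀_notMem hU ht₀⟩
      filter_upwards [hU', eventually_eval_ne_zero hQ] with t h1 h2
      rw [hh _ h1, hPQ t h2, hf, mul_comm]
    · refine isUnit_of_isRep hd (fun hP => h0 ?_) hQ hw
      rw [hPQ _ hQ, hP, zero_div]
  refine le_antisymm ?_ ?_
  · rw [zeroIdeal, Ideal.span_le]
    rintro v ⟨U, u, h, hU, ht₀, hu, hh, hv⟩
    obtain ⟨w, rfl, -⟩ := key U u h v hU ht₀ hu hh hv
    exact Ideal.mem_span_singleton.2 (dvd_mul_right g w)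
  · rw [Ideal.span_singleton_le_iff_mem]
    obtain ⟨U, u, hU, ht₀, hu, hu0⟩ := exists_local_trivialization hd (-l) (Γ.c₀ t₀).mk'
    have hus := hu.mul (hs.mono (Set.subset_univ U))
    rw [neg_add_cancel] at hus
    obtain ⟨h, hh, hreg⟩ := hus.exists_descent hd hU
    let v : localRing Γ.carrier (Γ.c₀ t₀).mk' := ⟨↑h, h, hreg _ ht₀, rfl⟩
    have hv : v ∈ zeroIdeal Γ.carrier (Γ.c₀ t₀).mk' l s :=
      Ideal.subset_span ⟨U, u, h, hU, ht₀, hu, hh, rfl⟩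
    obtain ⟨w, hw, hunit⟩ := key U u h v hU ht₀ hu hh rfl
    rw [hw] at hv
    exact (Ideal.mul_unit_mem_iff_mem _ (hunit (hu0 _ ht₀))).1 hv

theorem length_zeroIdeal [Infinite k] (hd : d₁ ≤ d₂) {f : k[X]} (hf0 : f ≠ 0)
    (hf : ∀ t, s (Γ.c₀ t) = f.eval t) (hs : IsSection l Set.univ s)
    {Z : Set (Hbar k N d₁ d₂)} (hZ : Z = Γ.carrier) (t₀ : k) :
    (Module.length (localRing Z (Γ.c₀ t₀).mk')
      (localRing Z (Γ.c₀ t₀).mk' ⧸ zeroIdeal Z (Γ.c₀ t₀).mk' l s)).toNat =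
      f.rootMultiplicity t₀ := by
  subst hZ
  have h1 : (1 : k[X]).eval t₀ ≠ 0 := by simp
  obtain ⟨g, hg⟩ := Γ.exists_of_div hd f h1
  have hg' : Γ.IsRep g fun t => f.eval t :=
    hg.congr (Filter.Eventually.of_forall fun t => by simp)
  rw [zeroIdeal_eq_span hd hf hs hg']
  have := ord_eq_rootMultiplicity hd hf0 hg'
  rw [Ring.ord] at this
  rw [this, ENat.toNat_natCast]

variable (Γ) in
/-- A section of `𝒪(l₁, l₂)` that does not vanish identically on the curve has as many zeros on it
as the degree of `𝒪(l₁, l₂)`. -/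
theorem zeroCount_eq [IsAlgClosed k] (hd : d₁ ≤ d₂) (hs : IsSection l Set.univ s)
    (h0 : ∃ c : Cone k N d₁ d₂, c.mk' ∈ Γ.carrier ∧ s c ≠ 0) :
    (zeroCount Γ.carrier l s : ℤ) = Γ.deg l := by
  classical
  have : Infinite k := IsAlgClosed.instInfinite
  obtain ⟨f₀, hf₀⟩ := Γ.exists_polynomial_of_isSection hs
  obtain ⟨f₁, hf₁⟩ := Γ.swap.exists_polynomial_of_isSection hs
  replace hf₁ : ∀ t, s (Γ.c₁ t) = f₁.eval t := hf₁
  have hglue : ∀ t : kˣ, f₁.eval ((t⁻¹ : kˣ) : k) =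
      ((t ^ (-Γ.deg l) : kˣ) : k) * f₀.eval (t : k) := fun t => by
    rw [← hf₁, ← hf₀, Γ.section_glue hs]
  have hne : f₀ ≠ 0 := by
    rintro rfl
    have hz : f₁ = 0 := by
      refine eq_of_infinite_eval_eq _ _ ((Set.finite_singleton (0 : k)).infinite_compl.mono
        fun x hx => ?_)
      have := hglue (Units.mk0 x hx)⁻¹
      rw [inv_inv, eval_zero, mul_zero] at this
      rw [Set.mem_ofPred_eq, eval_zero]
      exact this
    obtain ⟨c, hc, hsc⟩ := h0
    obtain ⟨t, ht⟩ | ht := (Γ.mem_carrier_iff hd _).1 hc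
    · refine hs.ne_zero_of_mk'_eq hd (Set.mem_univ _) ht.symm hsc ?_
      rw [hf₀, eval_zero]
    · refine hs.ne_zero_of_mk'_eq hd (Set.mem_univ _) ht.symm hsc ?_
      rw [hf₁, hz, eval_zero]
  have hne₁ : f₁ ≠ 0 := by
    rintro rfl
    refine hne (eq_of_infinite_eval_eq _ _ ((Set.finite_singleton (0 : k)).infinite_compl.mono
      fun x hx => ?_))
    have := hglue (Units.mk0 x hx)
    rw [eval_zero, eq_comm, mul_eq_zero] at this
    rw [Set.mem_ofPred_eq, eval_zero]
    exact this.resolve_left (Units.ne_zero _)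
  rw [← natDegree_add_rootMultiplicity_eq hne hglue]
  let e : Option k → Γ.carrier := fun o =>
    o.elim ⟨(Γ.c₁ 0).mk', Or.inr ⟨0, rfl⟩⟩ fun t => ⟨(Γ.c₀ t).mk', Or.inl ⟨t, rfl⟩⟩
  have he : Function.Bijective e := by
    constructor
    · rintro (_ | t) (_ | t') h
      · rfl
      · exact absurd (congrArg Subtype.val h).symm (Γ.mk'_c₀_ne hd t')
      · exact absurd (congrArg Subtype.val h) (Γ.mk'_c₀_ne hd t)
      · exact congrArg some (Γ.mk'_c₀_injective hd (congrArg Subtype.val h))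
    · rintro ⟨x, hx⟩
      obtain ⟨t, rfl⟩ | rfl := (Γ.mem_carrier_iff hd x).1 hx
      · exact ⟨some t, rfl⟩
      · exact ⟨none, rfl⟩
  let m : Option k → ℕ := fun o => o.elim (f₁.rootMultiplicity 0) fun t => f₀.rootMultiplicity t
  have hm : ∑ᶠ o, m o = zeroCount Γ.carrier l s := by
    refine finsum_eq_of_bijective e he ?_
    rintro (_ | t)
    · exact (Γ.swap.length_zeroIdeal hd hne₁ hf₁ hs Γ.swap_carrier.symm 0).symm
    · exact (Γ.length_zeroIdeal hd hne hf₀ hs rfl t).symm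
  rw [← hm, finsum_eq_sum_of_support_subset m (s := Finset.insertNone f₀.roots.toFinset)]
  · rw [Finset.sum_insertNone]
    have hsum : ∑ t ∈ f₀.roots.toFinset, m (some t) = f₀.natDegree := by
      rw [← IsAlgClosed.card_roots_eq_natDegree, ← Multiset.toFinset_sum_count_eq]
      exact Finset.sum_congr rfl fun t _ => (count_roots f₀).symm
    rw [hsum]
    push_cast
    exact add_comm _ _
  · rintro (_ | t) ht
    · simp
    · have ht' : f₀.rootMultiplicity t ≠ 0 := ht
      rw [Finset.mem_coe, Finset.some_mem_insertNone, Multiset.mem_toFinset, mem_roots hne]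
      exact (rootMultiplicity_pos hne).1 (Nat.pos_of_ne_zero ht')

variable (Γ) in
/-- Nef line bundles have nonnegative degree on rational curves. -/
theorem deg_nonneg_of_nef [IsAlgClosed k] (hd : d₁ ≤ d₂) (h : Nef k N d₁ d₂ l) : 0 ≤ Γ.deg l := by
  have : Infinite k := IsAlgClosed.instInfinite
  obtain ⟨n, ⟨a, b, s, t, rfl, hs, ht, hs0, ht0, rfl⟩, hn⟩ := h Γ.carrier (Γ.isCurve hd)
  rw [Γ.zeroCount_eq hd hs hs0, Γ.zeroCount_eq hd ht ht0] at hn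
  simp only [deg, Prod.fst_sub, Prod.snd_sub] at hn ⊢
  linarith

variable (Γ) in
/-- A section of a line bundle of degree zero is constant along the curve. -/
theorem eq_of_deg_eq_zero [IsAlgClosed k] (h0 : Γ.deg l = 0) (hs : IsSection l Set.univ s)
    (t t' : k) : s (Γ.c₀ t) = s (Γ.c₀ t') := by
  have : Infinite k := IsAlgClosed.instInfinite
  obtain ⟨f₀, hf₀⟩ := Γ.exists_polynomial_of_isSection hs
  obtain ⟨f₁, hf₁⟩ := Γ.swap.exists_polynomial_of_isSection hs
  replace hf₁ : ∀ t, s (Γ.c₁ t) = f₁.eval t := hf₁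
  rw [hf₀, hf₀]
  by_cases hne : f₀ = 0
  · rw [hne, eval_zero, eval_zero]
  · have := natDegree_add_rootMultiplicity_eq (f₁ := f₁) (e := Γ.deg l) hne fun t => by
      rw [← hf₁, ← hf₀, Γ.section_glue hs]
    rw [eq_C_of_natDegree_eq_zero (p := f₀) (by omega), eval_C, eval_C]

variable (Γ) in
/-- A line bundle of degree zero on a rational curve is not ample: all its powers contract the
curve to a point. -/
theorem not_ample_of_deg_eq_zero [IsAlgClosed k] (hd : d₁ ≤ d₂) (h0 : Γ.deg l = 0) :
    ¬ Ample k N d₁ d₂ l := by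
  rintro ⟨m, -, n, s, φ, hs, hφ, hclosed⟩
  have hm : Γ.deg (m • l) = 0 := by
    have : Γ.deg (m • l) = m * Γ.deg l := by
      simp only [deg, Prod.smul_fst, Prod.smul_snd]
      simp only [nsmul_eq_mul]
      ring
    rw [this, h0, mul_zero]
  obtain ⟨h₁, e₁⟩ := hφ (Γ.c₀ 0)
  obtain ⟨h₂, e₂⟩ := hφ (Γ.c₀ 1)
  have heq : φ (Γ.c₀ 0).mk' = φ (Γ.c₀ 1).mk' := by
    rw [e₁, e₂]
    congr 1
    funext i
    exact Γ.eq_of_deg_eq_zero hm (hs i) 0 1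
  exact zero_ne_one (Γ.mk'_c₀_injective hd (hclosed.1.injective heq))

end RationalCurve

end LocalRing

/-! ### Points and closed sets cut out by remainders -/

section Curves

open MvPolynomial

variable {k : Type*} [Field k] {N d₁ d₂ : ℕ}

/-- A nonzero form that is reduced with respect to `F` is not divisible by `F`. -/
theorem eq_zero_of_dvd_of_low {F G : MvPolynomial (Fin (N + 1)) k} {d : ℕ}
    (hF : F.IsHomogeneous d) (h0 : coeff (Finsupp.single 0 d) F ≠ 0) (hG : LowX₀ d G)
    (h : F ∣ G) : G = 0 := by
  obtain ⟨K, rfl⟩ := h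
  have hK : LowX₀ (K.totalDegree + 1) K := fun m hm => by
    refine coeff_eq_zero_of_totalDegree_lt ?_
    have := Finsupp.le_degree 0 m
    rw [Finsupp.degree_apply] at this
    omega
  have h1 := divRem_mul_self hF hK
  rw [mul_comm, divRem_of_low hG] at h1
  exact (mul_eq_zero.1 h1).resolve_left fun h => pow_ne_zero _ h0 (C_eq_zero.1 h)

theorem exists_poly_of_affine (c : k → Cone k N d₁ d₂) (F F' G G' : MvPolynomial (Fin (N + 1)) k)
    (hF : ∀ t, ((c t).F : MvPolynomial (Fin (N + 1)) k) = F + C t * F')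
    (hG : ∀ t, ((c t).G : MvPolynomial (Fin (N + 1)) k) = G + C t * G') :
    ∃ p : Mon N d₁ ⊕ Mon N d₂ → Polynomial k, ∀ t, (c t).coords = fun i => (p i).eval t := by
  refine ⟨Sum.elim
    (fun M => Polynomial.C (coeff M.1 F) + Polynomial.C (coeff M.1 F') * Polynomial.X)
    (fun M => Polynomial.C (coeff M.1 G) + Polynomial.C (coeff M.1 G') * Polynomial.X),
    fun t => ?_⟩
  funext i
  rcases i with M | M
  · simp [Cone.coords, coordsOf, hF, mul_comm t]
  · simp [Cone.coords, coordsOf, hG, mul_comm t]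

theorem isClosed_commonZeros (hd : d₁ ≤ d₂) {ι : Type*} (l : ι → ℤ × ℤ)
    (s : ι → Cone k N d₁ d₂ → k) (hs : ∀ i, IsSection (l i) Set.univ (s i)) :
    IsClosed {x : Hbar k N d₁ d₂ | ∀ i, x ∉ nonvanishing (s i)} := by
  have : {x : Hbar k N d₁ d₂ | ∀ i, x ∉ nonvanishing (s i)} = ⋂ i, (nonvanishing (s i))ᶜ := by
    ext x
    simp
  rw [this]
  exact isClosed_iInter fun i => ((hs i).isOpen_nonvanishing hd).isClosed_compl

theorem divRem_eq_of_remainderCoeff (hd : d₁ ≤ d₂) (γ : GL (Fin (N + 1)) k)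
    (c : Cone k N d₁ d₂) {R : MvPolynomial (Fin (N + 1)) k} (hR : R.IsHomogeneous d₂)
    (h : ∀ M : Mon N d₂, remainderCoeff (genericRem k N d₁ d₂) γ M c = coeff M.1 R) :
    divRem d₁ (substitute γ c.F) (d₂ - d₁ + 1) (substitute γ c.G) = R := by
  have hr := isHomogeneous_divRem (n := d₂ - d₁ + 1) hd (isHomogeneous_substitute γ c.F.2)
    (isHomogeneous_substitute γ c.G.2)
  ext m
  by_cases hm : m.degree = d₂
  · rw [← remainderCoeff_genericRem γ ⟨m, (mem_mon_iff m).2 hm⟩ c]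
    exact h _
  · rw [hr.coeff_eq_zero hm, hR.coeff_eq_zero hm]

/-- If the leading coefficient of `F` does not vanish, the point `[F, G]` is determined by `F` and
the remainder. -/
theorem mk'_eq_of_divRem_eq (hd : d₁ ≤ d₂) (γ : GL (Fin (N + 1)) k) {c c' : Cone k N d₁ d₂}
    {R : MvPolynomial (Fin (N + 1)) k}
    (hR : divRem d₁ (substitute γ c.F) (d₂ - d₁ + 1) (substitute γ c.G) = substitute γ R)
    (h0 : coeff (Finsupp.single 0 d₁) (substitute γ (c.F : MvPolynomial (Fin (N + 1)) k)) ≠ 0)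
    {a e : k} (ha : a ≠ 0) (he : e ≠ 0)
    (hF : (c'.F : MvPolynomial (Fin (N + 1)) k) = a • (c.F : MvPolynomial (Fin (N + 1)) k))
    (hG : (c'.G : MvPolynomial (Fin (N + 1)) k) = e • R) : c.mk' = c'.mk' := by
  have hid := divRem_identity d₁ (substitute γ c.F) (d₂ - d₁ + 1) (substitute γ c.G)
  set a₀ := coeff (Finsupp.single 0 d₁) (substitute γ (c.F : MvPolynomial (Fin (N + 1)) k))
  refine Cone.mk'_eq_of_dvd hd ha (b := e * a₀ ^ (d₂ - d₁ + 1))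
    (mul_ne_zero he (pow_ne_zero _ h0)) hF ?_
  rw [← substitute_dvd_substitute_iff γ, hG, map_sub, map_smul, map_smul, ← hR, mul_smul,
    ← smul_sub, smul_eq_C_mul _ (a₀ ^ _), C_pow, hid, sub_add_cancel_right, smul_neg, smul_eq_C_mul]
  exact (dvd_neg.2 ((dvd_mul_left _ _).mul_left _))

/-! ### Lines in the fibres over the base -/

/-- The pair `(X₀ ^ d₁, x M₀ + y M₁)`, where `M₀` and `M₁` are distinct monomials not divisible
by `X₀ ^ d₁`. -/
def fibreCone {M₀ M₁ : Mon N d₂} (hne : M₀ ≠ M₁) (h₀ : M₀.1 0 < d₁) (h₁ : M₁.1 0 < d₁) (x y : k)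
    (hxy : x ≠ 0 ∨ y ≠ 0) : Cone k N d₁ d₂ where
  F := ⟨monomial (Finsupp.single 0 d₁) 1, isHomogeneous_monomial _ (by simp)⟩
  G := ⟨monomial M₀.1 x + monomial M₁.1 y,
    (isHomogeneous_monomial _ ((mem_mon_iff _).1 M₀.2)).add
      (isHomogeneous_monomial _ ((mem_mon_iff _).1 M₁.2))⟩
  F_ne h := by
    have := congrArg (fun F : Forms k N d₁ =>
      coeff (Finsupp.single 0 d₁) (F : MvPolynomial (Fin (N + 1)) k)) h
    simp at this
  not_dvd h := by
    classical
    have hne' : M₀.1 ≠ M₁.1 := fun h => hne (Subtype.ext h)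
    have hlow : LowX₀ d₁ (monomial M₀.1 x + monomial M₁.1 y) := fun m hm => by
      have e₀ : M₀.1 ≠ m := by rintro rfl; omega
      have e₁ : M₁.1 ≠ m := by rintro rfl; omega
      rw [coeff_add, coeff_monomial, coeff_monomial, if_neg e₀, if_neg e₁, add_zero]
    have h0 := eq_zero_of_dvd_of_low (isHomogeneous_monomial 1 (by simp)) (by simp) hlow h
    have hx := congrArg (coeff M₀.1) h0
    have hy := congrArg (coeff M₁.1) h0
    simp [coeff_monomial, hne'.symm] at hx
    simp [coeff_monomial, hne'] at hy
    exact hxy.elim (fun h => h hx) (fun h => h hy)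

section Fibre

variable {M₀ M₁ : Mon N d₂} (hne : M₀ ≠ M₁) (h₀ : M₀.1 0 < d₁) (h₁ : M₁.1 0 < d₁)

theorem remainderCoeff_fibreCone {x y : k} (hxy : x ≠ 0 ∨ y ≠ 0) (M : Mon N d₂) :
    remainderCoeff (genericRem k N d₁ d₂) 1 M (fibreCone hne h₀ h₁ x y hxy) =
      coeff M.1 (monomial M₀.1 x + monomial M₁.1 y) := by
  classical
  have hlow : LowX₀ d₁ (monomial M₀.1 x + monomial M₁.1 y) := fun m hm => by
    have e₀ : M₀.1 ≠ m := by rintro rfl; omega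
    have e₁ : M₁.1 ≠ m := by rintro rfl; omega
    rw [coeff_add, coeff_monomial, coeff_monomial, if_neg e₀, if_neg e₁, add_zero]
  rw [remainderCoeff_genericRem, substitute_one, substitute_one]
  change coeff M.1 (divRem d₁ (monomial (Finsupp.single 0 d₁) 1) _
    (monomial M₀.1 x + monomial M₁.1 y)) = _
  rw [divRem_of_low hlow]
  simp

/-- The point `[F, G]` lies on a line in the fibre over `X₀ ^ d₁` if `F` is proportional to
`X₀ ^ d₁` and the remainder is a combination of `M₀` and `M₁`. -/
theorem exists_mk'_eq_fibreCone (hd : d₁ ≤ d₂) (c : Cone k N d₁ d₂)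
    (hF : ∀ m, m ≠ Finsupp.single 0 d₁ → coeff m (c.F : MvPolynomial (Fin (N + 1)) k) = 0)
    (hr : ∀ M, M ≠ M₀ → M ≠ M₁ → remainderCoeff (genericRem k N d₁ d₂) 1 M c = 0) :
    (∃ t, (fibreCone hne h₀ h₁ 1 t (Or.inl one_ne_zero)).mk' = c.mk') ∨
      (fibreCone hne h₀ h₁ (0 : k) 1 (Or.inr one_ne_zero)).mk' = c.mk' := by
  classical
  have hne' : M₀.1 ≠ M₁.1 := fun h => hne (Subtype.ext h)
  set a := coeff (Finsupp.single 0 d₁) (c.F : MvPolynomial (Fin (N + 1)) k) with ha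
  have hcF : (c.F : MvPolynomial (Fin (N + 1)) k) = monomial (Finsupp.single 0 d₁) a := by
    ext m
    rw [coeff_monomial]
    split_ifs with hm
    · rw [← hm]
    · exact hF m (Ne.symm hm)
  have ha0 : a ≠ 0 := by
    intro h
    rw [h, monomial_zero] at hcF
    exact c.F_ne (ZeroMemClass.coe_eq_zero.1 hcF)
  have hFa : (monomial (Finsupp.single 0 d₁) 1 : MvPolynomial (Fin (N + 1)) k) =
      a⁻¹ • (c.F : MvPolynomial (Fin (N + 1)) k) := by
    rw [hcF, smul_monomial, smul_eq_mul, inv_mul_cancel₀ ha0]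
  set x := remainderCoeff (genericRem k N d₁ d₂) 1 M₀ c with hx
  set y := remainderCoeff (genericRem k N d₁ d₂) 1 M₁ c with hy
  have hR := divRem_eq_of_remainderCoeff hd 1 c (R := monomial M₀.1 x + monomial M₁.1 y)
    ((isHomogeneous_monomial _ ((mem_mon_iff _).1 M₀.2)).add
      (isHomogeneous_monomial _ ((mem_mon_iff _).1 M₁.2))) (fun M => by
      rw [coeff_add, coeff_monomial, coeff_monomial]
      by_cases e₀ : M = M₀
      · subst e₀; rw [if_pos rfl, if_neg hne'.symm, add_zero]
      · by_cases e₁ : M = M₁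
        · subst e₁; rw [if_pos rfl, if_neg hne', zero_add]
        · rw [hr M e₀ e₁, if_neg fun h => e₀ (Subtype.ext h.symm),
            if_neg fun h => e₁ (Subtype.ext h.symm), add_zero])
  have hlead : coeff (Finsupp.single 0 d₁)
      (substitute 1 (c.F : MvPolynomial (Fin (N + 1)) k)) ≠ 0 := by
    rwa [substitute_one]
  rw [← substitute_one (monomial M₀.1 x + monomial M₁.1 y)] at hR
  by_cases hx0 : x = 0
  · right
    have hy0 : y ≠ 0 := by
      intro hy0
      have hid := divRem_identity d₁ (substitute 1 (c.F : MvPolynomial (Fin (N + 1)) k))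
        (d₂ - d₁ + 1) (substitute 1 (c.G : MvPolynomial (Fin (N + 1)) k))
      rw [hR, hx0, hy0, monomial_zero, monomial_zero, add_zero, map_zero, add_zero,
        substitute_one, substitute_one, ← C_pow] at hid
      refine c.not_dvd ?_
      rw [← ((isUnit_iff_ne_zero.2 (pow_ne_zero (d₂ - d₁ + 1) ha0)).map C).dvd_mul_left]
      exact ⟨_, hid.trans (mul_comm _ _)⟩
    refine (mk'_eq_of_divRem_eq hd 1 hR hlead (inv_ne_zero ha0) (inv_ne_zero hy0) hFa ?_).symm
    change monomial M₀.1 0 + monomial M₁.1 1 = _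
    rw [hx0, smul_add, smul_monomial, smul_monomial]
    simp [hy0]
  · left
    refine ⟨x⁻¹ * y,
      (mk'_eq_of_divRem_eq hd 1 hR hlead (inv_ne_zero ha0) (inv_ne_zero hx0) hFa ?_).symm⟩
    change monomial M₀.1 1 + monomial M₁.1 (x⁻¹ * y) = _
    rw [smul_add, smul_monomial, smul_monomial]
    simp [hx0]

/-- The line in the fibre over `X₀ ^ d₁` through the classes of two reduced monomials. -/
def fibreLine (hd : d₁ ≤ d₂) : RationalCurve k N d₁ d₂ where
  c₀ t := fibreCone hne h₀ h₁ 1 t (Or.inl one_ne_zero)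
  c₁ t := fibreCone hne h₀ h₁ t 1 (Or.inr one_ne_zero)
  poly₀ := exists_poly_of_affine _ (monomial (Finsupp.single 0 d₁) 1) 0 (monomial M₀.1 1)
    (monomial M₁.1 1) (fun t => by simp [fibreCone]) (fun t => by simp [fibreCone, C_mul_monomial])
  poly₁ := exists_poly_of_affine _ (monomial (Finsupp.single 0 d₁) 1) 0 (monomial M₁.1 1)
    (monomial M₀.1 1) (fun t => by simp [fibreCone])
    (fun t => by simp [fibreCone, C_mul_monomial, add_comm])
  α := 0
  β := -1
  glue t := by
    refine ⟨0, ?_, ?_⟩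
    · simp [fibreCone]
    · simp [fibreCone, smul_monomial]
  w := ((d₂ : ℤ) - d₁ + 1, 1)
  A := remainderCoeff (genericRem k N d₁ d₂) 1 M₁
  B := remainderCoeff (genericRem k N d₁ d₂) 1 M₀
  isSection_A := isSection_remainderCoeff hd _ 1 M₁
  isSection_B := isSection_remainderCoeff hd _ 1 M₀
  A_c₀ t := by
    classical
    have hne' : M₀.1 ≠ M₁.1 := fun h => hne (Subtype.ext h)
    rw [remainderCoeff_fibreCone]
    simp [coeff_monomial, hne']
  B_c₀ t := by
    classical
    have hne' : M₀.1 ≠ M₁.1 := fun h => hne (Subtype.ext h)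
    rw [remainderCoeff_fibreCone]
    simp [coeff_monomial, hne'.symm]
  A_c₁ t := by
    classical
    have hne' : M₀.1 ≠ M₁.1 := fun h => hne (Subtype.ext h)
    rw [remainderCoeff_fibreCone]
    simp [coeff_monomial, hne']
  B_c₁ t := by
    classical
    have hne' : M₀.1 ≠ M₁.1 := fun h => hne (Subtype.ext h)
    rw [remainderCoeff_fibreCone]
    simp [coeff_monomial, hne'.symm]
  isClosed' := by
    classical
    let s : {m : Fin (N + 1) →₀ ℕ // m ≠ Finsupp.single 0 d₁} ⊕
        {M : Mon N d₂ // M ≠ M₀ ∧ M ≠ M₁} → Cone k N d₁ d₂ → k :=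
      Sum.elim (fun m c => coeff m.1 (c.F : MvPolynomial (Fin (N + 1)) k))
        (fun M => remainderCoeff (genericRem k N d₁ d₂) 1 M.1)
    have hs : ∀ i, IsSection (Sum.elim (fun _ => (1, 0)) (fun _ => ((d₂ : ℤ) - d₁ + 1, 1)) i)
        Set.univ (s i) := by
      rintro (m | M)
      · exact isSection_coeff m.1
      · exact isSection_remainderCoeff hd _ 1 M.1
    have hz : ∀ (x y : k) (hxy : x ≠ 0 ∨ y ≠ 0) i, s i (fibreCone hne h₀ h₁ x y hxy) = 0 := by
      rintro x y hxy (⟨m, hm⟩ | ⟨M, hM₀, hM₁⟩)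
      · change coeff m (monomial (Finsupp.single 0 d₁) 1) = 0
        rw [coeff_monomial, if_neg hm.symm]
      · change remainderCoeff (genericRem k N d₁ d₂) 1 M (fibreCone hne h₀ h₁ x y hxy) = 0
        rw [remainderCoeff_fibreCone, coeff_add, coeff_monomial, coeff_monomial,
          if_neg fun h => hM₀ (Subtype.ext h.symm), if_neg fun h => hM₁ (Subtype.ext h.symm),
          add_zero]
    convert isClosed_commonZeros hd _ s hs using 1
    ext p
    constructor
    · rintro (⟨t, rfl⟩ | ⟨t, rfl⟩) i <;>
      · rw [(hs i).mk'_mem_nonvanishing hd, not_not]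
        exact hz _ _ _ i
    · intro hp
      obtain ⟨c, rfl⟩ := Cone.mk'_surjective p
      have hc : ∀ i, s i c = 0 := fun i => by
        have := hp i
        rwa [(hs i).mk'_mem_nonvanishing hd, not_not] at this
      obtain ⟨t, ht⟩ | h := exists_mk'_eq_fibreCone hne h₀ h₁ hd c
        (fun m hm => hc (Sum.inl ⟨m, hm⟩)) (fun M h h' => hc (Sum.inr ⟨M, h, h'⟩))
      · exact Or.inl ⟨t, ht⟩
      · exact Or.inr ⟨0, h⟩

theorem deg_fibreLine (hd : d₁ ≤ d₂) (l : ℤ × ℤ) :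
    (fibreLine (k := k) hne h₀ h₁ hd).deg l = l.2 := by
  simp [RationalCurve.deg, fibreLine]

end Fibre

end Curves

/-! ### The curve contracted by `𝒪(d₂ - d₁ + 1, 1)` -/

section Pencil

open MvPolynomial

variable {k : Type*} [Field k] {N d₁ d₂ : ℕ}

/-- The form `X₀ ^ (d₁ - 1) (v X₀ + u X_j)` of degree `d₁`. -/
def pencilF (d₁ : ℕ) (j : Fin (N + 1)) (u v : k) : MvPolynomial (Fin (N + 1)) k :=
  X 0 ^ (d₁ - 1) * (C v * X 0 + C u * X j)

/-- The form `X₀ ^ (d₁ - 1) (x X₀ + y X_j) ^ (d₂ - d₁ + 1)` of degree `d₂`. -/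
def pencilG (d₁ d₂ : ℕ) (j : Fin (N + 1)) (x y : k) : MvPolynomial (Fin (N + 1)) k :=
  X 0 ^ (d₁ - 1) * (C x * X 0 + C y * X j) ^ (d₂ - d₁ + 1)

variable {j : Fin (N + 1)}

theorem isHomogeneous_linear (j : Fin (N + 1)) (x y : k) :
    (C x * X 0 + C y * X j : MvPolynomial (Fin (N + 1)) k).IsHomogeneous 1 :=
  (isHomogeneous_C_mul_X _ _).add (isHomogeneous_C_mul_X _ _)

theorem isHomogeneous_pencilF (hd₁ : 1 ≤ d₁) (u v : k) :
    (pencilF d₁ j u v).IsHomogeneous d₁ := by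
  have := (isHomogeneous_X_pow (R := k) (0 : Fin (N + 1)) (d₁ - 1)).mul (isHomogeneous_linear j v u)
  rwa [Nat.sub_add_cancel hd₁] at this

theorem isHomogeneous_pencilG (hd₁ : 1 ≤ d₁) (hd : d₁ ≤ d₂) (x y : k) :
    (pencilG d₁ d₂ j x y).IsHomogeneous d₂ := by
  have := (isHomogeneous_X_pow (R := k) (0 : Fin (N + 1)) (d₁ - 1)).mul
    ((isHomogeneous_linear j x y).pow (d₂ - d₁ + 1))
  rwa [one_mul, show d₁ - 1 + (d₂ - d₁ + 1) = d₂ by omega] at this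

theorem pencilF_eq (hd₁ : 1 ≤ d₁) (u v : k) :
    pencilF d₁ j u v = monomial (Finsupp.single 0 d₁) v +
      monomial (Finsupp.single 0 (d₁ - 1) + Finsupp.single j 1) u := by
  obtain ⟨d, rfl⟩ := Nat.exists_eq_add_of_le' hd₁
  rw [pencilF, Nat.add_sub_cancel, mul_add, X_pow_eq_monomial, C_mul_X_eq_monomial,
    C_mul_X_eq_monomial, monomial_mul, monomial_mul, one_mul, one_mul, ← Finsupp.single_add]

theorem pencilG_zero (y : k) :
    pencilG d₁ d₂ j 0 y = monomial (Finsupp.single 0 (d₁ - 1) + Finsupp.single j (d₂ - d₁ + 1))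
      (y ^ (d₂ - d₁ + 1)) := by
  rw [pencilG, C_0, zero_mul, zero_add, mul_pow, ← C_pow, X_pow_eq_monomial, X_pow_eq_monomial,
    C_mul_monomial, mul_one, monomial_mul, one_mul]

theorem single_ne_of_ne_zero (hj : j ≠ 0) :
    (Finsupp.single 0 d₁ : Fin (N + 1) →₀ ℕ) ≠
      Finsupp.single 0 (d₁ - 1) + Finsupp.single j 1 := by
  intro h
  have := DFunLike.congr_fun h j
  simp [Finsupp.single_eq_of_ne hj] at this

theorem coeff_single_pencilF (hd₁ : 1 ≤ d₁) (hj : j ≠ 0) (u v : k) :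
    coeff (Finsupp.single 0 d₁) (pencilF d₁ j u v) = v := by
  classical
  rw [pencilF_eq hd₁, coeff_add, coeff_monomial, coeff_monomial, if_pos rfl,
    if_neg (single_ne_of_ne_zero hj).symm, add_zero]

theorem coeff_add_single_pencilF (hd₁ : 1 ≤ d₁) (hj : j ≠ 0) (u v : k) :
    coeff (Finsupp.single 0 (d₁ - 1) + Finsupp.single j 1) (pencilF d₁ j u v) = u := by
  classical
  rw [pencilF_eq hd₁, coeff_add, coeff_monomial, coeff_monomial, if_pos rfl,
    if_neg (single_ne_of_ne_zero hj), zero_add]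

theorem C_mul_pencilF (a u v : k) :
    C a * pencilF d₁ j u v = pencilF d₁ j (a * u) (a * v) := by
  rw [pencilF, pencilF, C_mul, C_mul]
  ring

theorem C_pow_mul_pencilG (a x y : k) :
    C (a ^ (d₂ - d₁ + 1)) * pencilG d₁ d₂ j x y = pencilG d₁ d₂ j (a * x) (a * y) := by
  have : (C (a * x) * X 0 + C (a * y) * X j : MvPolynomial (Fin (N + 1)) k) =
      C a * (C x * X 0 + C y * X j) := by
    rw [C_mul, C_mul]
    ring
  rw [pencilG, pencilG, this, mul_pow, C_pow]
  ring

/-- Modulo `v X₀ + u X_j`, a linear form `x X₀ + y X_j` is determined by its value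
`x u - y v` at `(u, -v)`. -/
theorem pencilF_dvd_sub {u v x y x' y' c : k} (hx : x' - x = c * v) (hy : y' - y = c * u) :
    pencilF d₁ j u v ∣ pencilG d₁ d₂ j x' y' - pencilG d₁ d₂ j x y := by
  rw [pencilF, pencilG, pencilG, ← mul_sub]
  refine mul_dvd_mul_left _ (Dvd.dvd.trans ⟨C c, ?_⟩ (sub_dvd_pow_sub_pow _ _ _))
  have hx' := congrArg (C (σ := Fin (N + 1))) hx
  have hy' := congrArg (C (σ := Fin (N + 1))) hy
  rw [C_sub, C_mul] at hx' hy'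
  linear_combination X 0 * hx' + X j * hy'

/-- The pair `(X₀ ^ (d₁ - 1) (v X₀ + u X_j), X₀ ^ (d₁ - 1) (x X₀ + y X_j) ^ (d₂ - d₁ + 1))`. -/
def pencilCone (hd₁ : 1 ≤ d₁) (hd : d₁ ≤ d₂) (hj : j ≠ 0) (u v x y : k) (h : x * u - y * v ≠ 0) :
    Cone k N d₁ d₂ where
  F := ⟨pencilF d₁ j u v, isHomogeneous_pencilF hd₁ u v⟩
  G := ⟨pencilG d₁ d₂ j x y, isHomogeneous_pencilG hd₁ hd x y⟩
  F_ne h0 := by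
    have h0' : pencilF d₁ j u v = 0 := congrArg Subtype.val h0
    have hv := coeff_single_pencilF hd₁ hj u v
    have hu := coeff_add_single_pencilF hd₁ hj u v
    rw [h0', coeff_zero] at hu hv
    rw [← hu, ← hv] at h
    simp at h
  not_dvd hdvd := by
    have hdvd' : pencilF d₁ j u v ∣ pencilG d₁ d₂ j x y := hdvd
    rw [pencilF, pencilG, mul_dvd_mul_iff_left (pow_ne_zero _ (X_ne_zero 0))] at hdvd'
    have := map_dvd (eval fun i => if i = 0 then u else if i = j then -v else 0) hdvd'
    simp only [map_add, map_mul, map_pow, eval_C, eval_X, if_true, if_neg hj] at this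
    rw [show v * u + u * -v = 0 by ring, zero_dvd_iff] at this
    refine h ?_
    linear_combination (pow_eq_zero_iff (Nat.succ_ne_zero (d₂ - d₁))).1 this

variable (hd₁ : 1 ≤ d₁) (hd : d₁ ≤ d₂) (hj : j ≠ 0)

/-- On the pencil, the point `[F, G]` depends only on the linear factor of `F` that moves. -/
theorem mk'_pencilCone {u v x y u' v' x' y' a : k} (h : x * u - y * v ≠ 0)
    (h' : x' * u' - y' * v' ≠ 0) (ha : a ≠ 0) (hu : u' = a * u) (hv : v' = a * v) :
    (pencilCone hd₁ hd hj u v x y h).mk' = (pencilCone hd₁ hd hj u' v' x' y' h').mk' := by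
  have h'' : x' * u - y' * v ≠ 0 := by
    intro h0
    refine h' ?_
    rw [hu, hv]
    linear_combination a * h0
  -- The scalar is the ratio of the values of the two linear forms at `(u, -v)`.
  refine Cone.mk'_eq_of_dvd hd ha (b := ((x' * u - y' * v) / (x * u - y * v)) ^ (d₂ - d₁ + 1))
    (pow_ne_zero _ (div_ne_zero h'' h)) ?_ ?_
  · change pencilF d₁ j u' v' = a • pencilF d₁ j u v
    rw [smul_eq_C_mul, C_mul_pencilF, hu, hv]
  · change pencilF d₁ j u v ∣ pencilG d₁ d₂ j x' y' - _ • pencilG d₁ d₂ j x y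
    rw [smul_eq_C_mul, C_pow_mul_pencilG]
    refine pencilF_dvd_sub (c := (x * y' - x' * y) / (x * u - y * v)) ?_ ?_
    · rw [div_mul_eq_mul_div, div_mul_eq_mul_div, sub_eq_iff_eq_add, ← add_div, eq_div_iff h]
      ring
    · rw [div_mul_eq_mul_div, div_mul_eq_mul_div, sub_eq_iff_eq_add, ← add_div, eq_div_iff h]
      ring

/-- The change of coordinates `X_j ↦ X_j + z X₀`. -/
def shear (hj : j ≠ 0) (z : k) : GL (Fin (N + 1)) k :=
  Matrix.GeneralLinearGroup.mkOfDetNeZero (Matrix.transvection j 0 z) (by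
    rw [Matrix.det_transvection_of_ne _ _ hj]
    exact one_ne_zero)

theorem substitute_shear_X_zero (z : k) : substitute (shear hj z) (X 0) = X 0 := by
  simp [substitute, shear, Matrix.GeneralLinearGroup.mkOfDetNeZero, Matrix.transvection,
    Matrix.one_apply, Matrix.single_apply, hj]

theorem substitute_shear_X (z : k) :
    substitute (shear hj z) (X j) = X j + C z * X 0 := by
  simp [substitute, shear, Matrix.GeneralLinearGroup.mkOfDetNeZero, Matrix.transvection,
    Matrix.one_apply, Matrix.single_apply, add_mul, Finset.sum_add_distrib,
    apply_ite (C : k →+* MvPolynomial (Fin (N + 1)) k)]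

theorem substitute_shear_pencilF (z u v : k) :
    substitute (shear hj z) (pencilF d₁ j u v) = pencilF d₁ j u (v + z * u) := by
  have hC : ∀ a : k, substitute (shear hj z) (C a) = C a := fun a => algHom_C _ a
  rw [pencilF, pencilF, map_mul, map_pow, map_add, map_mul, map_mul, substitute_shear_X_zero,
    substitute_shear_X, hC, hC, C_add, C_mul]
  ring

theorem substitute_shear_pencilG (z x y : k) :
    substitute (shear hj z) (pencilG d₁ d₂ j x y) = pencilG d₁ d₂ j (x + z * y) y := by
  have hC : ∀ a : k, substitute (shear hj z) (C a) = C a := fun a => algHom_C _ a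
  have h : (C (x + z * y) * X 0 + C y * X j : MvPolynomial (Fin (N + 1)) k) =
      C x * X 0 + C y * (X j + C z * X 0) := by
    rw [C_add, C_mul]
    ring
  rw [pencilG, pencilG, map_mul, map_pow, map_pow, map_add, map_mul, map_mul,
    substitute_shear_X_zero, substitute_shear_X, hC, hC, h]

/-- On the pencil, the remainder is a multiple of a fixed monomial: modulo `v X₀ + u X_j` with
`v ≠ 0`, every form in `X₀` and `X_j` is a multiple of a power of `X_j`. -/
theorem coeff_divRem_pencil (hd₁ : 1 ≤ d₁) (hd : d₁ ≤ d₂) (hj : j ≠ 0) {u v x y : k} (hv : v ≠ 0) {m : Fin (N + 1) →₀ ℕ}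
    (hm : m ≠ Finsupp.single 0 (d₁ - 1) + Finsupp.single j (d₂ - d₁ + 1)) :
    coeff m (divRem d₁ (pencilF d₁ j u v) (d₂ - d₁ + 1) (pencilG d₁ d₂ j x y)) = 0 := by
  classical
  have hdvd : pencilF d₁ j u v ∣
      pencilG d₁ d₂ j (v * x) (v * y) - pencilG d₁ d₂ j 0 (v * y - x * u) :=
    pencilF_dvd_sub (c := x) (by ring) (by ring)
  obtain ⟨K, hK⟩ := exists_form_of_dvd hd (isHomogeneous_pencilF hd₁ u v)
    ((isHomogeneous_pencilG hd₁ hd _ _).sub (isHomogeneous_pencilG hd₁ hd _ _)) hdvd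
  have hlow : LowX₀ d₁ (pencilG d₁ d₂ j 0 (v * y - x * u)) := fun m hm => by
    rw [pencilG_zero, coeff_monomial, if_neg]
    rintro rfl
    simp [Finsupp.single_eq_of_ne hj.symm] at hm
    omega
  have h1 : C (v ^ (d₂ - d₁ + 1)) * pencilG d₁ d₂ j x y =
      (K : MvPolynomial (Fin (N + 1)) k) * pencilF d₁ j u v + pencilG d₁ d₂ j 0 (v * y - x * u) := by
    rw [C_pow_mul_pencilG, ← hK, sub_add_cancel]
  have h2 := congrArg (divRem d₁ (pencilF d₁ j u v) (d₂ - d₁ + 1)) h1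
  rw [divRem_C_mul, divRem_add, divRem_mul_self (isHomogeneous_pencilF hd₁ u v)
    (LowX₀.of_isHomogeneous K.2), zero_add, divRem_of_low hlow] at h2
  have h3 := congrArg (coeff m) h2
  rw [coeff_C_mul, coeff_C_mul, pencilG_zero, coeff_monomial, if_neg hm.symm, mul_zero] at h3
  exact (mul_eq_zero.1 h3).resolve_left (pow_ne_zero _ hv)

/-- The point `[F, G]` lies on the pencil if `F` has the shape `X₀ ^ (d₁ - 1) (v X₀ + u X_j)`
and the remainder, in a coordinate system where the leading coefficient of `F` is not zero, is a
multiple of `X₀ ^ (d₁ - 1) X_j ^ (d₂ - d₁ + 1)`. -/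
theorem exists_mk'_eq_pencilCone (c : Cone k N d₁ d₂) {u v : k}
    (hF : (c.F : MvPolynomial (Fin (N + 1)) k) = pencilF d₁ j u v) {z : k} (hz : v + z * u ≠ 0)
    (hr : ∀ M : Mon N d₂, M.1 ≠ Finsupp.single 0 (d₁ - 1) + Finsupp.single j (d₂ - d₁ + 1) →
      remainderCoeff (genericRem k N d₁ d₂) (shear hj z) M c = 0) :
    ∃ x y, ∃ h : x * u - y * v ≠ 0, (pencilCone hd₁ hd hj u v x y h).mk' = c.mk' := by
  classical
  have hlead : coeff (Finsupp.single 0 d₁)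
      (substitute (shear hj z) (c.F : MvPolynomial (Fin (N + 1)) k)) = v + z * u := by
    rw [hF, substitute_shear_pencilF, coeff_single_pencilF hd₁ hj]
  have hdeg : (Finsupp.single 0 (d₁ - 1) + Finsupp.single j (d₂ - d₁ + 1) :
      Fin (N + 1) →₀ ℕ).degree = d₂ := by
    rw [map_add, Finsupp.degree_single, Finsupp.degree_single]
    omega
  set ρ := remainderCoeff (genericRem k N d₁ d₂) (shear hj z) ⟨_, (mem_mon_iff _).2 hdeg⟩ c with hρ
  have hR := divRem_eq_of_remainderCoeff hd (shear hj z) c (R := ρ • pencilG d₁ d₂ j 0 1)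
    (by
      rw [smul_eq_C_mul]
      exact (isHomogeneous_pencilG hd₁ hd 0 1).C_mul ρ) (fun M => by
      rw [coeff_smul, pencilG_zero, coeff_monomial, one_pow]
      split_ifs with hM
      · rw [smul_eq_mul, mul_one, hρ]
        congr 1
        exact Subtype.ext hM.symm
      · rw [smul_zero, hr M (Ne.symm hM)])
  have hsub : substitute (shear hj z) (ρ • pencilG d₁ d₂ j (-z) 1) =
      ρ • pencilG d₁ d₂ j 0 1 := by
    rw [map_smul, substitute_shear_pencilG, mul_one, neg_add_cancel]
  rw [← hsub] at hR
  have hρ0 : ρ ≠ 0 := by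
    intro h0
    have hid := divRem_identity d₁ (substitute (shear hj z) (c.F : MvPolynomial (Fin (N + 1)) k))
      (d₂ - d₁ + 1) (substitute (shear hj z) (c.G : MvPolynomial (Fin (N + 1)) k))
    rw [hR, h0, zero_smul, map_zero, add_zero, hlead, ← C_pow] at hid
    refine c.not_dvd ?_
    rw [← substitute_dvd_substitute_iff (shear hj z),
      ← ((isUnit_iff_ne_zero.2 (pow_ne_zero (d₂ - d₁ + 1) hz)).map C).dvd_mul_left]
    exact ⟨_, hid.trans (mul_comm _ _)⟩
  refine ⟨-z, 1, ?_, ?_⟩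
  · intro h0
    refine hz ?_
    linear_combination -h0
  · refine (mk'_eq_of_divRem_eq hd (shear hj z) hR ?_ one_ne_zero (inv_ne_zero hρ0) ?_ ?_).symm
    · rwa [hlead]
    · change pencilF d₁ j u v = (1 : k) • (c.F : MvPolynomial (Fin (N + 1)) k)
      rw [hF, one_smul]
    · change pencilG d₁ d₂ j (-z) 1 = _
      rw [smul_smul, inv_mul_cancel₀ hρ0, one_smul]

/-- The pencil is a common zero locus of sections: the coefficients of `F` that vanish on it, and the
coefficients of the remainders in all the coordinate systems `X_j ↦ X_j + z X₀`, other than that of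
`X₀ ^ (d₁ - 1) X_j ^ (d₂ - d₁ + 1)`. Two values of `z` make up for the zeros of the leading
coefficient of `F`. -/
theorem isClosed_pencil :
    IsClosed ((Set.range fun t : k => (pencilCone hd₁ hd hj t 1 0 1 (by simp)).mk') ∪
      Set.range fun t : k => (pencilCone hd₁ hd hj 1 t (-1) 0 (by simp)).mk') := by
  classical
  let e₀ : Fin (N + 1) →₀ ℕ := Finsupp.single 0 d₁
  let e₁ : Fin (N + 1) →₀ ℕ := Finsupp.single 0 (d₁ - 1) + Finsupp.single j 1
  let e : Fin (N + 1) →₀ ℕ := Finsupp.single 0 (d₁ - 1) + Finsupp.single j (d₂ - d₁ + 1)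
  -- The factor in front of the remainder is the leading coefficient of `F` after the shear.
  let s : {m : Fin (N + 1) →₀ ℕ // m ≠ e₀ ∧ m ≠ e₁} ⊕ k × {M : Mon N d₂ // M.1 ≠ e} →
      Cone k N d₁ d₂ → k :=
    Sum.elim (fun m c => coeff m.1 (c.F : MvPolynomial (Fin (N + 1)) k))
      (fun p c => (coeff e₀ (c.F : MvPolynomial (Fin (N + 1)) k) +
        -(-p.1) * coeff e₁ (c.F : MvPolynomial (Fin (N + 1)) k)) *
        remainderCoeff (genericRem k N d₁ d₂) (shear hj p.1) p.2.1 c)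
  have hs : ∀ i, IsSection
      (Sum.elim (fun _ => (1, 0)) (fun _ => (1, 0) + ((d₂ : ℤ) - d₁ + 1, 1)) i)
      Set.univ (s i) := by
    rintro (m | p)
    · exact isSection_coeff m.1
    · exact ((isSection_coeff e₀).sub_const_mul (isSection_coeff e₁) (-p.1)).mul
        (isSection_remainderCoeff hd _ (shear hj p.1) p.2.1)
  have hz : ∀ (u v x y : k) (h : x * u - y * v ≠ 0) i,
      s i (pencilCone hd₁ hd hj u v x y h) = 0 := by
    rintro u v x y h (⟨m, hm₀, hm₁⟩ | ⟨z, M, hM⟩)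
    · change coeff m (pencilF d₁ j u v) = 0
      rw [pencilF_eq hd₁, coeff_add, coeff_monomial, coeff_monomial, if_neg hm₀.symm,
        if_neg hm₁.symm, add_zero]
    · change (coeff e₀ (pencilF d₁ j u v) + -(-z) * coeff e₁ (pencilF d₁ j u v)) *
        remainderCoeff (genericRem k N d₁ d₂) (shear hj z) M
          (pencilCone hd₁ hd hj u v x y h) = 0
      rw [coeff_single_pencilF hd₁ hj, coeff_add_single_pencilF hd₁ hj, neg_neg,
        remainderCoeff_genericRem]
      change (v + z * u) * coeff M.1 (divRem d₁ (substitute (shear hj z) (pencilF d₁ j u v))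
        (d₂ - d₁ + 1) (substitute (shear hj z) (pencilG d₁ d₂ j x y))) = 0
      rw [substitute_shear_pencilF, substitute_shear_pencilG]
      by_cases hv : v + z * u = 0
      · rw [hv, zero_mul]
      · rw [coeff_divRem_pencil hd₁ hd hj hv hM, mul_zero]
  convert isClosed_commonZeros hd _ s hs using 1
  ext p
  constructor
  · rintro (⟨t, rfl⟩ | ⟨t, rfl⟩) i <;>
    · rw [(hs i).mk'_mem_nonvanishing hd, not_not]
      exact hz _ _ _ _ _ i
  · intro hp
    obtain ⟨c, rfl⟩ := Cone.mk'_surjective p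
    have hc : ∀ i, s i c = 0 := fun i => by
      have := hp i
      rwa [(hs i).mk'_mem_nonvanishing hd, not_not] at this
    set v := coeff e₀ (c.F : MvPolynomial (Fin (N + 1)) k) with hv
    set u := coeff e₁ (c.F : MvPolynomial (Fin (N + 1)) k) with hu
    have hF : (c.F : MvPolynomial (Fin (N + 1)) k) = pencilF d₁ j u v := by
      rw [pencilF_eq hd₁]
      ext m
      rw [coeff_add, coeff_monomial, coeff_monomial]
      by_cases h₀ : m = e₀
      · rw [if_pos h₀.symm, if_neg (by rw [h₀]; exact (single_ne_of_ne_zero hj).symm), add_zero,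
          hv, h₀]
      · by_cases h₁ : m = e₁
        · rw [if_neg (Ne.symm h₀), if_pos h₁.symm, zero_add, hu, h₁]
        · rw [if_neg (Ne.symm h₀), if_neg (Ne.symm h₁), add_zero]
          exact hc (Sum.inl ⟨m, h₀, h₁⟩)
    have huv : u ≠ 0 ∨ v ≠ 0 := by
      by_contra! h0
      rw [h0.1, h0.2, pencilF, C_0, zero_mul, zero_mul, add_zero, mul_zero] at hF
      exact c.F_ne (ZeroMemClass.coe_eq_zero.1 hF)
    obtain ⟨z, hz'⟩ : ∃ z, v + z * u ≠ 0 := by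
      by_cases h0 : v = 0
      · exact ⟨1, by simpa [h0] using huv⟩
      · exact ⟨0, by simpa using h0⟩
    obtain ⟨x, y, hxy, hmk⟩ := exists_mk'_eq_pencilCone hd₁ hd hj c hF hz' fun M hM => by
      have h0 : (v + -(-z) * u) *
        remainderCoeff (genericRem k N d₁ d₂) (shear hj z) M c = 0 := hc (Sum.inr (z, ⟨M, hM⟩))
      rw [neg_neg] at h0
      exact (mul_eq_zero.1 h0).resolve_left hz'
    rw [← hmk]
    by_cases h0 : v = 0
    · have hu0 : u ≠ 0 := huv.resolve_right (not_not.2 h0)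
      exact Or.inr ⟨0, mk'_pencilCone hd₁ hd hj _ hxy hu0 (mul_one u).symm (by simp [h0])⟩
    · exact Or.inl ⟨v⁻¹ * u, mk'_pencilCone hd₁ hd hj _ hxy h0
        (mul_inv_cancel_left₀ h0 u).symm (mul_one v).symm⟩

/-- The curve of pairs `(X₀ ^ (d₁ - 1) L, X₀ ^ (d₁ - 1) H)`, where `L` runs through the linear forms
in `X₀` and `X_j`, and `H` is a form of degree `d₂ - d₁ + 1` in `X₀` and `X_j`, which matters only
up to a factor modulo `L`. -/
def pencil : RationalCurve k N d₁ d₂ where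
  c₀ t := pencilCone hd₁ hd hj t 1 0 1 (by simp)
  -- The sign makes the transition factor between the two forms `G` a power of `t`.
  c₁ t := pencilCone hd₁ hd hj 1 t (-1) 0 (by simp)
  poly₀ := exists_poly_of_affine _ (pencilF d₁ j 0 1) (pencilF d₁ j 1 0) (pencilG d₁ d₂ j 0 1) 0
    (fun t => by simp [pencilCone, pencilF]; ring) (fun t => by simp [pencilCone])
  poly₁ := exists_poly_of_affine _ (pencilF d₁ j 1 0) (pencilF d₁ j 0 1) (pencilG d₁ d₂ j (-1) 0) 0
    (fun t => by simp [pencilCone, pencilF]; ring) (fun t => by simp [pencilCone])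
  α := -1
  β := (d₂ - d₁ + 1 : ℕ)
  glue t := by
    have hdvd : pencilF d₁ j (t : k) 1 ∣
        pencilG d₁ d₂ j (-1) 0 - pencilG d₁ d₂ j ((t : k) * 0) ((t : k) * 1) :=
      pencilF_dvd_sub (c := -1) (by simp) (by simp)
    obtain ⟨K, hK⟩ := exists_form_of_dvd hd (isHomogeneous_pencilF hd₁ (t : k) 1)
      ((isHomogeneous_pencilG hd₁ hd _ _).sub (isHomogeneous_pencilG hd₁ hd _ _)) hdvd
    refine ⟨K, ?_, ?_⟩
    · change pencilF d₁ j 1 ((t⁻¹ : kˣ) : k) = _ • pencilF d₁ j (t : k) 1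
      rw [smul_eq_C_mul, C_mul_pencilF]
      simp
    · change pencilG d₁ d₂ j (-1) 0 = _ • pencilG d₁ d₂ j 0 1 +
        (K : MvPolynomial (Fin (N + 1)) k) * pencilF d₁ j (t : k) 1
      rw [← hK, smul_eq_C_mul, zpow_natCast, Units.val_pow_eq_pow_val, C_pow_mul_pencilG]
      ring
  w := (1, 0)
  A c := coeff (Finsupp.single 0 (d₁ - 1) + Finsupp.single j 1)
    (c.F : MvPolynomial (Fin (N + 1)) k)
  B c := coeff (Finsupp.single 0 d₁) (c.F : MvPolynomial (Fin (N + 1)) k)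
  isSection_A := isSection_coeff _
  isSection_B := isSection_coeff _
  A_c₀ t := coeff_add_single_pencilF hd₁ hj t 1
  B_c₀ t := coeff_single_pencilF hd₁ hj t 1
  A_c₁ t := coeff_add_single_pencilF hd₁ hj 1 t
  B_c₁ t := coeff_single_pencilF hd₁ hj 1 t
  isClosed' := isClosed_pencil hd₁ hd hj

theorem deg_pencil (l : ℤ × ℤ) :
    (pencil (k := k) hd₁ hd hj).deg l = l.1 - ((d₂ : ℤ) - d₁ + 1) * l.2 := by
  have hD : ((d₂ - d₁ + 1 : ℕ) : ℤ) = (d₂ : ℤ) - d₁ + 1 := by omega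
  simp only [RationalCurve.deg, pencil, hD]
  ring

/-- Unless `N = 1` and `d₁ = 1`, there are two distinct monomials of degree `d₂` that are not
divisible by `X₀ ^ d₁`. -/
theorem exists_two_monomials (hN : 1 ≤ N) (hd₁ : 1 ≤ d₁) (hd : d₁ < d₂) (h : ¬ (N = 1 ∧ d₁ = 1)) :
    ∃ M₀ M₁ : Mon N d₂, M₀ ≠ M₁ ∧ M₀.1 0 < d₁ ∧ M₁.1 0 < d₁ := by
  obtain ⟨n, rfl⟩ := Nat.exists_eq_add_of_le' hN
  have h10 : (1 : Fin (n + 2)) ≠ 0 := by simp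
  have hdeg : (Finsupp.single (1 : Fin (n + 2)) d₂).degree = d₂ := Finsupp.degree_single _ _
  by_cases hd1 : d₁ = 1
  · obtain ⟨m, rfl⟩ : ∃ m, n = m + 1 := Nat.exists_eq_succ_of_ne_zero (by omega)
    have hmod : 2 % (m + 1 + 2) = 2 := Nat.mod_eq_of_lt (by omega)
    have h20 : (2 : Fin (m + 1 + 2)) ≠ 0 := by
      simp [Fin.ext_iff, hmod]
    have h21 : (2 : Fin (m + 1 + 2)) ≠ 1 := by
      simp [Fin.ext_iff, hmod]
    refine ⟨⟨_, (mem_mon_iff _).2 hdeg⟩, ⟨Finsupp.single 2 d₂, (mem_mon_iff _).2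
      (Finsupp.degree_single _ _)⟩, fun he => ?_, ?_, ?_⟩
    · have := DFunLike.congr_fun (congrArg Subtype.val he) 2
      simp [Finsupp.single_eq_of_ne h21] at this
      omega
    · simp [Finsupp.single_eq_of_ne h10.symm]
      omega
    · simp [Finsupp.single_eq_of_ne h20.symm]
      omega
  · refine ⟨⟨_, (mem_mon_iff _).2 hdeg⟩, ⟨Finsupp.single 0 1 + Finsupp.single 1 (d₂ - 1),
      (mem_mon_iff _).2 ?_⟩, fun he => ?_, ?_, ?_⟩
    · rw [map_add, Finsupp.degree_single, Finsupp.degree_single]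
      omega
    · have := DFunLike.congr_fun (congrArg Subtype.val he) 0
      simp [Finsupp.single_eq_of_ne h10.symm] at this
    · simp [Finsupp.single_eq_of_ne h10.symm]
      omega
    · simp [Finsupp.single_eq_of_ne h10.symm]
      omega

end Pencil

end CompleteIntersection

end

open CompleteIntersection in
theorem mainTheorem7 {k : Type*} [Field k] [IsAlgClosed k] (N d₁ d₂ : ℕ)
    (hN : 1 ≤ N) (hd₁ : 1 ≤ d₁) (hd : d₁ < d₂) :
    BasePointFree k N d₁ d₂ ((d₂ : ℤ) - d₁ + 1, 1) ∧
    ¬ Ample k N d₁ d₂ ((d₂ : ℤ) - d₁ + 1, 1) ∧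
    (¬ (N = 1 ∧ d₁ = 1) → ∀ l : ℤ × ℤ, Nef k N d₁ d₂ l ↔
      ∃ a b : ℕ, l = a • ((1 : ℤ), (0 : ℤ)) + b • ((d₂ : ℤ) - d₁ + 1, (1 : ℤ))) ∧
    ∃ q r : MvPolynomial (Fin (N + 1)) (CoeffRing k N d₁ d₂), IsFormalDivision q r ∧
      (∀ (γ : GL (Fin (N + 1)) k) (M : Mon N d₂),
        IsSection ((d₂ : ℤ) - d₁ + 1, 1) Set.univ (remainderCoeff r γ M)) ∧
      ∀ x : Hbar k N d₁ d₂, ∃ (γ : GL (Fin (N + 1)) k) (M : Mon N d₂) (c : Cone k N d₁ d₂),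
        c.mk' = x ∧ remainderCoeff r γ M c ≠ 0 := by
  have : Infinite k := IsAlgClosed.instInfinite
  have hj : Fin.last N ≠ 0 := by
    rw [Ne, Fin.ext_iff, Fin.val_last, Fin.val_zero]
    omega
  have hpencil := deg_pencil (k := k) hd₁ hd.le hj
  refine ⟨basePointFree_remainder hd.le,
    (pencil hd₁ hd.le hj).not_ample_of_deg_eq_zero hd.le (by rw [hpencil]; ring),
    fun h l => ⟨fun hl => ?_, ?_⟩, _, genericRem k N d₁ d₂, isFormalDivision_genericRem k N hd.le,
    fun γ M => isSection_remainderCoeff hd.le _ γ M, fun x => ?_⟩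
  · obtain ⟨M₀, M₁, hne, h₀, h₁⟩ := exists_two_monomials hN hd₁ hd h
    have hb := (fibreLine (k := k) hne h₀ h₁ hd.le).deg_nonneg_of_nef hd.le hl
    have ha := (pencil hd₁ hd.le hj).deg_nonneg_of_nef hd.le hl
    rw [deg_fibreLine] at hb
    rw [hpencil] at ha
    refine ⟨(l.1 - ((d₂ : ℤ) - d₁ + 1) * l.2).toNat, l.2.toNat, ?_⟩
    conv_lhs => rw [eq_smul_add_smul l ((d₂ : ℤ) - d₁ + 1)]
    rw [← natCast_zsmul, ← natCast_zsmul, Int.toNat_of_nonneg ha, Int.toNat_of_nonneg hb]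
  · rintro ⟨a, b, rfl⟩
    exact nef_of_eq hd.le a b
  · obtain ⟨c, rfl⟩ := Cone.mk'_surjective x
    obtain ⟨γ, M, hγ⟩ := exists_remainderCoeff_ne_zero hd.le c
    exact ⟨γ, M, c, rfl, hγ⟩
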